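/- Let $S=k[x_1,\dots,x_n]$ be a polynomial ring over a field $k$ of characteristic $0$, with maximal graded ideal $\mathfrak M=(x_1,\dots,x_n)$. For a graded $S$-module $M$ let $a_i(M)=\max\{d \mid H^i_{\mathfrak M}(M)_d\neq 0\}$, where $a_i(M)=-\infty$ if $H^i_{\mathfrak M}(M)=0$, and for $t\ge 0$ put $$\operatorname{reg}_t(M)=\max\{a_i(M)+i\mid i\le t\},\qquad a^*_t(M)=\max\{a_i(M)\mid i\le t\}.$$ For a monomial $x^A\ne 1$ let $m(x^A)$ be the largest $j$ such that $x_j$ divides $x^A$. Let $I$ be a Borel-fixed monomial ideal of $S$, i.e. a monomial ideal with $g(I)=I$ for every invertible upper triangular matrix $g$, acting by $x_j\mapsto\sum_i g_{ij}x_i$; assume $I\neq 0$ and $I\ne S$. Then for every $t\ge 0$: (i) $\operatorname{reg}_t(S/I)+1=\operatorname{reg}_{t+1}(I)$ is the maximum of $\deg(x^A)$ over the minimal monomial generators $x^A$ of $I$ with $m(x^A)\ge n-t$; (ii) $a^*_t(S/I)=a^*_{t+1}(I)$ is the maximum of $\deg(x^A)+m(x^A)-n-1$ over the minimal monomial generators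 $x^A$ of $I$ with $m(x^A)\ge n-t$. Here $\operatorname{reg}_{t+1}(I)$ and $a^*_{t+1}(I)$ are those of the graded module $I$, and the maximum of the empty set is $-\infty$. -/

import Mathlib

open MvPolynomial

noncomputable section

namespace BorelCohomology

/-! Graded local cohomology with support in the ideal `(x_1, …, x_n)` of the polynomial ring
`S = k[x_1, …, x_n] = MvPolynomial (Fin n) k` (the variable `x_{j+1}` is `X j`), computed by the
graded Čech complex on `x_1, …, x_n`. A graded `S`-module is an `S`-module `M` together with its
family `ℳ : ℤ → AddSubgroup M` of homogeneous parts. -/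

section LocalCohomology

/-- The multiplicative set of all monomials in the variables `X j`, `j ∈ F`. -/
def varMonoid (k : Type*) [Field k] {n : ℕ} (F : Finset (Fin n)) :
    Submonoid (MvPolynomial (Fin n) k) :=
  Submonoid.closure ((fun j => (X j : MvPolynomial (Fin n) k)) '' (F : Set (Fin n)))

theorem varMonoid_mono (k : Type*) [Field k] {n : ℕ} {F G : Finset (Fin n)} (h : F ⊆ G) :
    varMonoid k F ≤ varMonoid k G :=
  Submonoid.closure_mono (Set.image_mono (Finset.coe_subset.mpr h))

/-- The localization `M_F` of `M` obtained by inverting the variables `X j`, `j ∈ F`. -/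
abbrev Loc (k : Type*) [Field k] {n : ℕ} (M : Type*) [AddCommGroup M]
    [Module (MvPolynomial (Fin n) k) M] (F : Finset (Fin n)) : Type _ :=
  LocalizedModule (varMonoid k F) M

/-- The canonical map `M_F → M_G` for `F ⊆ G`. -/
def locMap (k : Type*) [Field k] {n : ℕ} (M : Type*) [AddCommGroup M]
    [Module (MvPolynomial (Fin n) k) M] {F G : Finset (Fin n)} (h : F ⊆ G) :
    Loc k M F →ₗ[MvPolynomial (Fin n) k] Loc k M G :=
  IsLocalizedModule.liftOfLE (varMonoid k F) (varMonoid k G) (varMonoid_mono k h)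
    (LocalizedModule.mkLinearMap (varMonoid k F) M)
    (LocalizedModule.mkLinearMap (varMonoid k G) M)

/-- The Čech differential on `∏_F M_F`:
`(δ c)_F = ∑_{j ∈ F} (-1)^{#{l ∈ F, l < j}} c_{F ∖ {j}}`. -/
def cechD (k : Type*) [Field k] (n : ℕ) (M : Type*) [AddCommGroup M]
    [Module (MvPolynomial (Fin n) k) M] :
    (∀ F : Finset (Fin n), Loc k M F) →ₗ[MvPolynomial (Fin n) k]
      (∀ F : Finset (Fin n), Loc k M F) :=
  LinearMap.pi fun F => ∑ j ∈ F, ((-1 : MvPolynomial (Fin n) k) ^ (F.filter (fun l => l < j)).card) •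
    (locMap k M (Finset.erase_subset j F) ∘ₗ LinearMap.proj (F.erase j))

/-- The degree `d` part of `M_F`: it consists of the fractions `m / s` with `s` a monomial of degree
`e` and `m` homogeneous of degree `d + e`. -/
def locPart {k : Type*} [Field k] {n : ℕ} {M : Type*} [AddCommGroup M]
    [Module (MvPolynomial (Fin n) k) M] (ℳ : ℤ → AddSubgroup M) (F : Finset (Fin n)) (d : ℤ) :
    AddSubgroup (Loc k M F) :=
  AddSubgroup.closure {z | ∃ (m : M) (s : varMonoid k F) (e : ℕ),
    (s : MvPolynomial (Fin n) k).IsHomogeneous e ∧ m ∈ ℳ (d + e) ∧ z = LocalizedModule.mk m s}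

/-- The Čech cochains of cohomological degree `i` and internal degree `d`, i.e. the degree `d` part
of `⨁_{#F = i} M_F`. -/
def cechCochains {k : Type*} [Field k] {n : ℕ} {M : Type*} [AddCommGroup M]
    [Module (MvPolynomial (Fin n) k) M] (ℳ : ℤ → AddSubgroup M) (i : ℕ) (d : ℤ) :
    AddSubgroup (∀ F : Finset (Fin n), Loc k M F) where
  carrier := {c | ∀ F, c F ∈ locPart ℳ F d ∧ (F.card ≠ i → c F = 0)}
  zero_mem' := fun _ => ⟨zero_mem _, fun _ => rfl⟩
  add_mem' := fun {a b} ha hb F => ⟨add_mem (ha F).1 (hb F).1, fun h => by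
    rw [Pi.add_apply, (ha F).2 h, (hb F).2 h, add_zero]⟩
  neg_mem' := fun {a} ha F => ⟨neg_mem (ha F).1, fun h => by
    rw [Pi.neg_apply, (ha F).2 h, neg_zero]⟩

/-- The cocycles of cohomological degree `i` and internal degree `d`. -/
def cechCocycles {k : Type*} [Field k] {n : ℕ} {M : Type*} [AddCommGroup M]
    [Module (MvPolynomial (Fin n) k) M] (ℳ : ℤ → AddSubgroup M) (i : ℕ) (d : ℤ) :
    AddSubgroup (∀ F : Finset (Fin n), Loc k M F) :=
  cechCochains ℳ i d ⊓ (cechD k n M).toAddMonoidHom.ker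

/-- The coboundaries of cohomological degree `i` and internal degree `d`. -/
def cechCoboundaries {k : Type*} [Field k] {n : ℕ} {M : Type*} [AddCommGroup M]
    [Module (MvPolynomial (Fin n) k) M] (ℳ : ℤ → AddSubgroup M) (i : ℕ) (d : ℤ) :
    AddSubgroup (∀ F : Finset (Fin n), Loc k M F) :=
  match i with
  | 0 => ⊥
  | i + 1 => (cechCochains ℳ i d).map (cechD k n M).toAddMonoidHom

/-- The degree `d` part `H^i(M)_d` of the `i`-th local cohomology module of the graded module `M`
with support in the maximal graded ideal of `S`. -/
abbrev LocalCohomologyPart {k : Type*} [Field k] {n : ℕ} {M : Type*} [AddCommGroup M]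
    [Module (MvPolynomial (Fin n) k) M] (ℳ : ℤ → AddSubgroup M) (i : ℕ) (d : ℤ) : Type _ :=
  cechCocycles (k := k) (n := n) ℳ i d ⧸
    (cechCoboundaries (k := k) (n := n) ℳ i d).addSubgroupOf (cechCocycles ℳ i d)

end LocalCohomology

section Invariants

/-- The integers together with `-∞ = ⊥` and `∞ = ⊤`; a complete linear order, in which the supremum
of the empty set is `-∞`. -/
abbrev ExtInt : Type := WithBot (WithTop ℤ)

/-- The inclusion of the integers. -/
def toExt (d : ℤ) : ExtInt := ((d : WithTop ℤ) : WithBot (WithTop ℤ))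

/-- `a_i(M)`: the largest `d` with `H^i(M)_d ≠ 0`, and `-∞` if `H^i(M) = 0`. -/
def aInv (k : Type*) [Field k] (n : ℕ) {M : Type*} [AddCommGroup M]
    [Module (MvPolynomial (Fin n) k) M] (ℳ : ℤ → AddSubgroup M) (i : ℕ) : ExtInt :=
  ⨆ d ∈ {d : ℤ | Nontrivial (LocalCohomologyPart (k := k) (n := n) ℳ i d)}, toExt d

/-- `reg_t(M) = max {a_i(M) + i | i ≤ t}`. -/
def regT (k : Type*) [Field k] (n : ℕ) {M : Type*} [AddCommGroup M]
    [Module (MvPolynomial (Fin n) k) M] (ℳ : ℤ → AddSubgroup M) (t : ℕ) : ExtInt :=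
  ⨆ i ∈ {i : ℕ | i ≤ t}, (aInv k n ℳ i + toExt i)

/-- `a*_t(M) = max {a_i(M) | i ≤ t}`. -/
def aStarT (k : Type*) [Field k] (n : ℕ) {M : Type*} [AddCommGroup M]
    [Module (MvPolynomial (Fin n) k) M] (ℳ : ℤ → AddSubgroup M) (t : ℕ) : ExtInt :=
  ⨆ i ∈ {i : ℕ | i ≤ t}, aInv k n ℳ i

end Invariants

section Gradings

/-- The standard grading of `S`, indexed by `ℤ` (zero in negative degrees). -/
def polyGrading (k : Type*) [Field k] (n : ℕ) (d : ℤ) : AddSubgroup (MvPolynomial (Fin n) k) :=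
  if 0 ≤ d then (homogeneousSubmodule (Fin n) k d.toNat).toAddSubgroup else ⊥

/-- The grading of `S / I` induced by the standard grading of `S`. -/
def quotGrading {k : Type*} [Field k] {n : ℕ} (I : Ideal (MvPolynomial (Fin n) k)) (d : ℤ) :
    AddSubgroup (MvPolynomial (Fin n) k ⧸ I) :=
  (polyGrading k n d).map (Ideal.Quotient.mk I).toAddMonoidHom

/-- The grading of the ideal `I`, viewed as an `S`-module, induced by the standard grading
of `S`. -/
def idealGrading {k : Type*} [Field k] {n : ℕ} (I : Ideal (MvPolynomial (Fin n) k)) (d : ℤ) :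
    AddSubgroup I :=
  (polyGrading k n d).comap (Submodule.subtype I).toAddMonoidHom

end Gradings

section Ideals

/-- `I` is generated by monomials. -/
def IsMonomialIdeal {k : Type*} [Field k] {n : ℕ} (I : Ideal (MvPolynomial (Fin n) k)) : Prop :=
  ∃ s : Set (Fin n →₀ ℕ), I = Ideal.span ((fun A => (monomial A (1 : k))) '' s)

/-- The action of a matrix `g` on `S`: the `k`-algebra homomorphism with
`x_j ↦ ∑_i g_{ij} x_i`. -/
def matAct {k : Type*} [Field k] {n : ℕ} (g : Matrix (Fin n) (Fin n) k) :
    MvPolynomial (Fin n) k →ₐ[k] MvPolynomial (Fin n) k :=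
  aeval fun j => ∑ i, C (g i j) * X i

/-- `I` is Borel-fixed: it is a monomial ideal with `g(I) = I` for all invertible upper triangular
matrices `g`. -/
def IsBorelFixed {k : Type*} [Field k] {n : ℕ} (I : Ideal (MvPolynomial (Fin n) k)) : Prop :=
  IsMonomialIdeal I ∧ ∀ g : GL (Fin n) k, (∀ i j : Fin n, j < i → g.val i j = 0) →
    matAct g.val '' (I : Set (MvPolynomial (Fin n) k)) = I

/-- `x^A` is a minimal (monomial) generator of the monomial ideal `I`: it is minimal with respect to
divisibility among the monomials of `I`. -/
def IsMinGen {k : Type*} [Field k] {n : ℕ} (I : Ideal (MvPolynomial (Fin n) k))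
    (A : Fin n →₀ ℕ) : Prop :=
  Minimal (fun B : Fin n →₀ ℕ => monomial B (1 : k) ∈ I) A

/-- `m(x^A)`: the largest index `j ∈ {1, …, n}` such that `x_j` divides `x^A`
(and `0` if `x^A = 1`). -/
def maxIndex {n : ℕ} (A : Fin n →₀ ℕ) : ℕ :=
  A.support.sup fun j => (j : ℕ) + 1

end Ideals

end BorelCohomology

end

/-! For a monomial ideal, the Čech complexes of `S / I` and of `I` split over multidegrees `α ∈ ℤⁿ`,
and every localization has dimension at most one in each `α`. The strand at `α` is therefore the
alternating complex on a family of sets `F` of variables, those for which the localization at `F` is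
nonzero in degree `α` (`locHom_cechD`, `nontrivial_localCohomologyPart_iff`).

In characteristic 0 a Borel-fixed ideal is strongly stable: exponents may be moved to earlier
variables. Hence, if `x^α` is not in `I` and `F` contains the negative places of `α`, then `x^α`
enters `I` after inverting `F` exactly when some `j ∈ F` satisfies `Reaches`. For `S / I` the family
is a Boolean interval, from the negative places to the non-reaching places, or empty. It has
cohomology only when these two sets coincide (`IsCritical`), and then in degree the number of
negative places. For `I` a critical `α` contributes one degree higher; the only other classes are
those of the top local cohomology of `S`, at `α` with all entries negative.

Reaching is inherited by smaller indices, so the negative places of a critical `α` form a final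
segment. Let `j` be the last reaching index: keeping the entries before `j`, taking the least
exponent at `j` that lands in `I`, and putting zeros afterwards gives a minimal generator with last
index `n` minus the number of negative places, and with degree at least `|α|` plus that number plus
1. Conversely, divide a minimal generator by its last variable, then raise the following variables
one after another as far as possible outside `I`; if the next variable can be raised indefinitely,
put `-1` from there on. The result is critical and satisfies the opposite degree inequality. These
two passages bound each side of the theorem by the other. -/

noncomputable section

namespace BorelCohomology

/-! ### Alternating complexes on families of finite sets -/

section Combinatorics

open Finset

variable {k : Type*} [CommRing k] {n : ℕ}

/-- The sign `(-1)^{#{l ∈ F, l < j}}`. -/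
def cechSign (k : Type*) [CommRing k] {n : ℕ} (F : Finset (Fin n)) (j : Fin n) : k :=
  (-1) ^ (F.filter (fun l => l < j)).card

theorem cechSign_mul_self (F : Finset (Fin n)) (j : Fin n) :
    cechSign k F j * cechSign k F j = 1 := by
  rw [cechSign, ← mul_pow]; simp

theorem cechSign_erase_of_le {F : Finset (Fin n)} {l j : Fin n} (h : j ≤ l) :
    cechSign k (F.erase l) j = cechSign k F j := by
  rw [cechSign, cechSign, filter_erase, erase_eq_of_notMem]
  simp [h]

theorem cechSign_erase_of_lt {F : Finset (Fin n)} {l j : Fin n} (hl : l ∈ F) (h : l < j) :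
    cechSign k (F.erase l) j = - cechSign k F j := by
  have hl' : l ∈ F.filter (fun l => l < j) := by simp [hl, h]
  rw [cechSign, cechSign, filter_erase, ← card_erase_add_one hl', pow_succ]
  ring

/-- Of the two removals, only that of the smaller index first changes the other sign. This is the
sign rule behind `δ² = 0`. -/
theorem cechSign_swap {F : Finset (Fin n)} {l j : Fin n} (hl : l ∈ F) (hj : j ∈ F) (h : l ≠ j) :
    cechSign k F l * cechSign k (F.erase l) j = -(cechSign k F j * cechSign k (F.erase j) l) := by
  rcases lt_or_gt_of_ne h with h | h
  · rw [cechSign_erase_of_lt hl h, cechSign_erase_of_le h.le]; ring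
  · rw [cechSign_erase_of_lt hj h, cechSign_erase_of_le h.le]; ring

/-- `c` is a cochain of degree `i` on the family `𝒟` of subsets of `Fin n`. -/
def IsCochainOn (𝒟 : Set (Finset (Fin n))) (i : ℕ) (c : Finset (Fin n) → k) : Prop :=
  ∀ F, c F ≠ 0 → F ∈ 𝒟 ∧ F.card = i

open Classical in
/-- The alternating differential, truncated to the family `𝒟`. -/
def diffOn (𝒟 : Set (Finset (Fin n))) (c : Finset (Fin n) → k) (F : Finset (Fin n)) : k :=
  if F ∈ 𝒟 then ∑ j ∈ F, cechSign k F j * c (F.erase j) else 0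

/-- `c` is a coboundary of degree `i` on the family `𝒟`. -/
def IsCoboundaryOn (𝒟 : Set (Finset (Fin n))) (i : ℕ) (c : Finset (Fin n) → k) : Prop :=
  match i with
  | 0 => c = 0
  | i + 1 => ∃ b, IsCochainOn 𝒟 i b ∧ diffOn 𝒟 b = c

/-- Every cocycle of degree `i` on `𝒟` is a coboundary. -/
def ExactAt (k : Type*) [CommRing k] {n : ℕ} (𝒟 : Set (Finset (Fin n))) (i : ℕ) : Prop :=
  ∀ c : Finset (Fin n) → k, IsCochainOn 𝒟 i c → diffOn 𝒟 c = 0 → IsCoboundaryOn 𝒟 i c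

theorem diffOn_of_mem {𝒟 : Set (Finset (Fin n))} {F : Finset (Fin n)} (h : F ∈ 𝒟)
    (c : Finset (Fin n) → k) : diffOn 𝒟 c F = ∑ j ∈ F, cechSign k F j * c (F.erase j) := if_pos h

theorem diffOn_of_notMem {𝒟 : Set (Finset (Fin n))} {F : Finset (Fin n)} (h : F ∉ 𝒟)
    (c : Finset (Fin n) → k) : diffOn 𝒟 c F = 0 := if_neg h

theorem diffOn_zero (𝒟 : Set (Finset (Fin n))) : diffOn 𝒟 (0 : Finset (Fin n) → k) = 0 := by
  funext F; simp [diffOn]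

/-- A family which is invariant under adding or removing `j` has an acyclic complex. -/
theorem exactAt_of_insert {𝒟 : Set (Finset (Fin n))} (j : Fin n)
    (h : ∀ F, j ∉ F → (insert j F ∈ 𝒟 ↔ F ∈ 𝒟)) (i : ℕ) : ExactAt k 𝒟 i := by
  intro c hc hd
  -- The contracting homotopy that inserts `j`.
  set b : Finset (Fin n) → k :=
    fun F => if j ∈ F then 0 else cechSign k F j * c (insert j F) with hb
  have hbd : diffOn 𝒟 b = c := by
    funext F
    by_cases hF : F ∈ 𝒟
    swap
    · rw [diffOn_of_notMem hF]
      by_contra h0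
      exact hF (hc F (Ne.symm h0)).1
    rw [diffOn_of_mem hF]
    by_cases hj : j ∈ F
    · rw [Finset.sum_eq_single_of_mem j hj]
      · simp only [hb, notMem_erase, if_false, insert_erase hj]
        rw [cechSign_erase_of_le le_rfl, ← mul_assoc, cechSign_mul_self, one_mul]
      · intro l _ hlj
        simp [hb, hj, hlj.symm]
    -- For `j ∉ F`, the cocycle condition at `insert j F` expresses `c F` through the values of `c`
    -- at sets containing `j`.
    · have h1 := congrFun hd (insert j F)
      rw [diffOn_of_mem ((h F hj).2 hF), sum_insert hj, erase_insert hj, Pi.zero_apply] at h1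
      have h2 : ∀ l ∈ F, cechSign k F l * b (F.erase l) =
          -(cechSign k (insert j F) j) *
            (cechSign k (insert j F) l * c ((insert j F).erase l)) := by
        intro l hl
        have hlj : l ≠ j := fun e => hj (e ▸ hl)
        have hs := cechSign_swap (k := k) (mem_insert_of_mem (b := j) hl) (mem_insert_self j F) hlj
        have hs2 := cechSign_mul_self (k := k) (insert j F) j
        have hs3 : cechSign k ((insert j F).erase l) j = cechSign k (F.erase l) j := by
          rw [erase_insert_of_ne hlj.symm, ← cechSign_erase_of_le (k := k) (F := insert j _) le_rfl,
            erase_insert (by simp [hj])]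
        have hs4 := cechSign_mul_self (k := k) (F.erase l) j
        rw [erase_insert hj, hs3] at hs
        have hb' : b (F.erase l) = cechSign k (F.erase l) j * c ((insert j F).erase l) := by
          simp [hb, hj, erase_insert_of_ne hlj.symm]
        rw [hb']
        linear_combination (-cechSign k F l * cechSign k (F.erase l) j * c ((insert j F).erase l)) * hs2
          + cechSign k (insert j F) j * cechSign k (F.erase l) j * c ((insert j F).erase l) * hs
          - cechSign k (insert j F) j * cechSign k (insert j F) l * c ((insert j F).erase l) * hs4
      rw [sum_congr rfl h2, ← mul_sum]
      have hs2 := cechSign_mul_self (k := k) (insert j F) j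
      linear_combination (-cechSign k (insert j F) j) * h1 + c F * hs2
  have hbc : ∀ F, b F ≠ 0 → F ∈ 𝒟 ∧ F.card + 1 = i := by
    intro F hF
    by_cases hj : j ∈ F
    · simp [hb, hj] at hF
    · have h1 : c (insert j F) ≠ 0 := by
        intro h0; simp [hb, hj, h0] at hF
      have h2 := hc _ h1
      rw [card_insert_of_notMem hj] at h2
      exact ⟨(h F hj).1 h2.1, h2.2⟩
  cases i with
  | zero =>
    have : b = 0 := by
      funext F
      by_contra h0
      exact absurd (hbc F h0).2 (by omega)
    rw [this, diffOn_zero] at hbd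
    exact hbd.symm
  | succ i => exact ⟨b, fun F hF => ⟨(hbc F hF).1, by have := (hbc F hF).2; omega⟩, hbd⟩

theorem exactAt_empty (i : ℕ) : ExactAt k (∅ : Set (Finset (Fin n))) i := by
  intro c hc _
  have : c = 0 := by
    funext F
    by_contra h0
    exact (hc F h0).1
  subst this
  cases i with
  | zero => rfl
  | succ i => exact ⟨0, fun F hF => absurd rfl hF, diffOn_zero _⟩

/-- Removing an element always leaves the family, so the differential is zero and the only
cohomology is a copy of `k` in degree `G.card`. -/
theorem exactAt_singleton_iff [Nontrivial k] (G : Finset (Fin n)) (i : ℕ) :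
    ExactAt k {G} i ↔ i ≠ G.card := by
  have hdiff : ∀ c : Finset (Fin n) → k, (∀ F, c F ≠ 0 → F = G) → diffOn {G} c = 0 := by
    intro c hc
    funext F
    by_cases hF : F = G
    · subst hF
      rw [diffOn_of_mem (Set.mem_singleton F)]
      refine sum_eq_zero fun j hj => ?_
      have : c (F.erase j) = 0 := by
        by_contra h0
        have := hc _ h0
        rw [erase_eq_self] at this
        exact this hj
      rw [this, mul_zero]
    · exact diffOn_of_notMem (𝒟 := {G}) hF _
  constructor
  · rintro h rfl
    have h1 : IsCochainOn (k := k) {G} G.card (Pi.single G 1) := by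
      intro F hF
      have : F = G := by
        by_contra h0
        simp [h0] at hF
      subst this
      exact ⟨rfl, rfl⟩
    have hne : (Pi.single G 1 : Finset (Fin n) → k) ≠ 0 := by
      intro h0
      simpa using congrFun h0 G
    have h2 := h _ h1 (hdiff _ fun F hF => (h1 F hF).1)
    cases hi : G.card with
    | zero => rw [hi] at h2; exact hne h2
    | succ i =>
      rw [hi] at h2
      obtain ⟨b, hb, hbd⟩ := h2
      rw [hdiff b fun F hF => (hb F hF).1] at hbd
      exact hne hbd.symm
  · intro hi c hc _
    have : c = 0 := by
      funext F
      by_contra h0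
      obtain ⟨h1, h2⟩ := hc F h0
      exact hi (h2 ▸ congrArg card h1)
    subst this
    cases i with
    | zero => rfl
    | succ i => exact ⟨0, fun F hF => absurd rfl hF, diffOn_zero _⟩

/-- This is `δ² = 0`: the terms for the two orders of removing a pair cancel. -/
theorem sum_cechSign_sum_cechSign (c : Finset (Fin n) → k) (F : Finset (Fin n)) :
    ∑ l ∈ F, cechSign k F l *
      ∑ j ∈ F.erase l, cechSign k (F.erase l) j * c ((F.erase l).erase j) = 0 := by
  simp_rw [mul_sum]
  rw [sum_sigma']
  refine sum_involution (fun x _ => ⟨x.2, x.1⟩) ?_ ?_ ?_ ?_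
  · rintro ⟨l, j⟩ h
    simp only [mem_sigma, mem_erase] at h
    have := cechSign_swap (k := k) h.1 h.2.2 h.2.1.symm
    simp only [erase_right_comm (a := j) (b := l)]
    linear_combination c ((F.erase l).erase j) * this
  · rintro ⟨l, j⟩ h _ h'
    simp only [mem_sigma, mem_erase] at h
    simp only [Sigma.mk.injEq, heq_eq_eq] at h'
    exact h.2.1 h'.1
  · rintro ⟨l, j⟩ h
    simp only [mem_sigma, mem_erase] at h ⊢
    exact ⟨h.2.2, h.2.1.symm, h.1⟩
  · rintro ⟨l, j⟩ h
    rfl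

theorem exactAt_superset {G : Finset (Fin n)} (hG : G ≠ univ) (i : ℕ) :
    ExactAt k {F | G ⊆ F} i := by
  obtain ⟨j, hj⟩ : ∃ j, j ∉ G := by
    by_contra! h
    exact hG (eq_univ_of_forall h)
  refine exactAt_of_insert j (fun F _ => ?_) i
  simp only [Set.mem_ofPred_eq]
  rw [subset_insert_iff_of_notMem hj]

/-- The family of all supersets of `G` is acyclic. Deleting its bottom element `G` leaves exactly
one class, one degree above `G.card`: the boundary of the indicator of `G`. -/
theorem exactAt_ssuperset_iff [Nontrivial k] {G : Finset (Fin n)} (hG : G ≠ univ) (i : ℕ) :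
    ExactAt k {F | G ⊂ F} i ↔ i ≠ G.card + 1 := by
  constructor
  · rintro h rfl
    set c : Finset (Fin n) → k := diffOn {F | G ⊆ F} (Pi.single G 1) with hc
    have hcG : c G = 0 := by
      rw [hc, diffOn_of_mem (by simp)]
      refine sum_eq_zero fun j hj => ?_
      rw [Pi.single_eq_of_ne, mul_zero]
      rw [Ne, erase_eq_self]
      exact fun h => h hj
    have h1 : IsCochainOn {F | G ⊂ F} (G.card + 1) c := by
      intro F hF
      by_cases hGF : G ⊆ F
      swap
      · exact absurd (diffOn_of_notMem hGF _) hF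
      rw [hc, diffOn_of_mem hGF] at hF
      obtain ⟨j, hj, hj'⟩ := exists_ne_zero_of_sum_ne_zero hF
      have h2 : F.erase j = G := by
        by_contra h0
        simp [Pi.single_eq_of_ne h0] at hj'
      subst h2
      exact ⟨erase_ssubset hj, (card_erase_add_one hj).symm⟩
    have hcF : ∀ F, c F = ∑ j ∈ F, cechSign k F j * (Pi.single G 1 : Finset (Fin n) → k) (F.erase j) := by
      intro F
      by_cases hGF : G ⊆ F
      · exact diffOn_of_mem hGF _
      · rw [hc, diffOn_of_notMem hGF]
        refine (sum_eq_zero fun j hj => ?_).symm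
        rw [Pi.single_eq_of_ne, mul_zero]
        rintro rfl
        exact hGF (erase_subset _ _)
    have h2 : diffOn {F | G ⊂ F} c = 0 := by
      funext F
      by_cases hGF : G ⊂ F
      · rw [diffOn_of_mem hGF]
        simp_rw [hcF]
        exact sum_cechSign_sum_cechSign _ F
      · exact diffOn_of_notMem hGF _
    obtain ⟨b, hb, hbd⟩ := h c h1 h2
    -- A primitive would have degree `G.card`, but every member of the family is strictly larger
    -- than `G`.
    have hb0 : b = 0 := by
      funext F
      by_contra h0
      obtain ⟨h3, h4⟩ := hb F h0
      exact absurd (card_lt_card h3) (by omega)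
    rw [hb0, diffOn_zero] at hbd
    obtain ⟨j, hj⟩ : ∃ j, j ∉ G := by
      by_contra! h
      exact hG (eq_univ_of_forall h)
    have h5 : c (insert j G) = 0 := by rw [← hbd]; rfl
    rw [hcF, sum_insert hj, erase_insert hj, Pi.single_eq_same, sum_eq_zero, add_zero, mul_one] at h5
    · have := cechSign_mul_self (k := k) (insert j G) j
      rw [h5, zero_mul] at this
      exact zero_ne_one this
    · intro l hl
      rw [Pi.single_eq_of_ne, mul_zero]
      intro h6
      rw [← h6] at hl
      simp at hl
  · intro hi c hc hd
    have h1 : IsCochainOn {F | G ⊆ F} i c := fun F hF => ⟨ssubset_iff_subset_ne.1 (hc F hF).1 |>.1, (hc F hF).2⟩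
    have h2 : diffOn {F | G ⊆ F} c = 0 := by
      funext F
      by_cases hF : G ⊂ F
      · rw [diffOn_of_mem (show F ∈ {F | G ⊆ F} from hF.subset), ← diffOn_of_mem (𝒟 := {F | G ⊂ F}) hF, hd]
      · by_cases hF' : G ⊆ F
        · rw [diffOn_of_mem hF']
          refine sum_eq_zero fun j hj => ?_
          by_contra h0
          have h3 := (hc _ (right_ne_zero_of_mul h0)).1
          exact hF (h3.trans (erase_ssubset hj))
        · exact diffOn_of_notMem hF' _
    have h3 := exactAt_superset (k := k) hG i c h1 h2
    cases i with
    | zero => exact h3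
    | succ i =>
      obtain ⟨b, hb, hbd⟩ := h3
      refine ⟨b, fun F hF => ⟨?_, (hb F hF).2⟩, ?_⟩
      -- The primitive found in the larger family lives in a degree different from `G.card`, so it
      -- vanishes at `G`.
      · refine ssubset_iff_subset_ne.2 ⟨(hb F hF).1, ?_⟩
        rintro rfl
        exact hi (by rw [(hb _ hF).2])
      · funext F
        by_cases hF : G ⊂ F
        · rw [← hbd, diffOn_of_mem (𝒟 := {F | G ⊂ F}) hF, diffOn_of_mem hF.subset]
        · rw [diffOn_of_notMem hF]
          by_contra h0
          exact hF (hc F (Ne.symm h0)).1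

end Combinatorics

/-! ### Multigraded coordinates on localizations and the splitting of the Čech complex -/

section Coordinates

variable {k : Type*} [Field k] {n : ℕ} {M : Type*} [AddCommGroup M]
    [Module (MvPolynomial (Fin n) k) M]

theorem mem_varMonoid_iff {F : Finset (Fin n)} {s : MvPolynomial (Fin n) k} :
    s ∈ varMonoid k F ↔ ∃ B : Fin n →₀ ℕ, B.support ⊆ F ∧ s = monomial B 1 := by
  constructor
  · intro hs
    induction hs using Submonoid.closure_induction with
    | mem x hx =>
      obtain ⟨j, hj, rfl⟩ := hx
      exact ⟨Finsupp.single j 1, (Finsupp.support_single_subset).trans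
        (Finset.singleton_subset_iff.2 hj), rfl⟩
    | one => exact ⟨0, by simp, rfl⟩
    | mul x y _ _ hx hy =>
      obtain ⟨B, hB, rfl⟩ := hx
      obtain ⟨C, hC, rfl⟩ := hy
      exact ⟨B + C, Finsupp.support_add.trans (Finset.union_subset hB hC), by
        rw [monomial_mul, one_mul]⟩
  · rintro ⟨B, hB, rfl⟩
    rw [monomial_eq, C_1, one_mul, Finsupp.prod]
    refine Submonoid.prod_mem _ fun j hj => Submonoid.pow_mem _ (Submonoid.subset_closure ?_) _
    exact ⟨j, hB hj, rfl⟩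

theorem monomial_add_smul (B C : Fin n →₀ ℕ) (m : M) :
    monomial (B + C) (1 : k) • m = monomial B (1 : k) • monomial C (1 : k) • m := by
  rw [smul_smul, monomial_mul, one_mul]

theorem support_add_subset {F : Finset (Fin n)} {B C : Fin n →₀ ℕ} (hB : B.support ⊆ F)
    (hC : C.support ⊆ F) : (B + C).support ⊆ F :=
  Finsupp.support_add.trans (Finset.union_subset hB hC)

/-- The exponent vector `B` as an integer vector. -/
def intExp (B : Fin n →₀ ℕ) : Fin n → ℤ := fun j => B j

@[simp] theorem intExp_apply (B : Fin n →₀ ℕ) (j : Fin n) : intExp B j = B j := rfl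

theorem intExp_add (B C : Fin n →₀ ℕ) : intExp (B + C) = intExp B + intExp C := by
  funext j; simp

theorem intExp_le {B C : Fin n →₀ ℕ} : intExp B ≤ intExp C ↔ B ≤ C := by
  rw [Pi.le_def, Finsupp.le_def]
  simp

theorem sum_intExp (B : Fin n →₀ ℕ) : ∑ j, intExp B j = B.degree := by
  rw [Finsupp.degree_eq_sum]
  simp

theorem intExp_sub_of_le {B C : Fin n →₀ ℕ} (h : B ≤ C) :
    intExp (C - B) = intExp C - intExp B := by
  funext j
  have := h j
  simp [Nat.cast_sub this]

/-- The multidegrees occurring in the localization at `F` of a multigraded module whose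
multidegrees are those in `T`. -/
def locSupport (T : Set (Fin n → ℤ)) (F : Finset (Fin n)) : Set (Fin n → ℤ) :=
  {α | ∃ C : Fin n →₀ ℕ, C.support ⊆ F ∧
    ∀ C' : Fin n →₀ ℕ, C'.support ⊆ F → C ≤ C' → α + intExp C' ∈ T}

/-- `κ` identifies `M` with the finitely supported functions on `T ⊆ ℤⁿ`, in such a way that
monomials act by translation and `ℳ` is the grading by total degree. -/
structure IsMonomialCoord (ℳ : ℤ → AddSubgroup M) (T : Set (Fin n → ℤ))
    (κ : M →+ ((Fin n → ℤ) → k)) : Prop where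
  ordConnected : T.OrdConnected
  injective : Function.Injective κ
  finite (m : M) : (Function.support (κ m)).Finite
  mem_of_ne_zero {m : M} {α : Fin n → ℤ} : κ m α ≠ 0 → α ∈ T
  exists_of_support (f : (Fin n → ℤ) → k) : (Function.support f).Finite →
    (∀ α, f α ≠ 0 → α ∈ T) → ∃ m, κ m = f
  smul (B : Fin n →₀ ℕ) (m : M) {α : Fin n → ℤ} : α ∈ T →
    κ (monomial B (1 : k) • m) α = κ m (α - intExp B)
  mem_iff (m : M) (d : ℤ) : m ∈ ℳ d ↔ ∀ α, κ m α ≠ 0 → ∑ j, α j = d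

open Classical in
/-- The exponent of a monomial. -/
def monExp (s : MvPolynomial (Fin n) k) : Fin n →₀ ℕ :=
  if h : ∃ B : Fin n →₀ ℕ, s = monomial B 1 then h.choose else 0

theorem monExp_monomial (B : Fin n →₀ ℕ) : monExp (monomial B (1 : k)) = B := by
  have h : ∃ B' : Fin n →₀ ℕ, monomial B (1 : k) = monomial B' 1 := ⟨B, rfl⟩
  rw [monExp, dif_pos h]
  exact (monomial_left_injective one_ne_zero h.choose_spec).symm

variable {ℳ : ℤ → AddSubgroup M} {T : Set (Fin n → ℤ)} {κ : M →+ ((Fin n → ℤ) → k)}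

namespace IsMonomialCoord

open Classical in
/-- The coordinates on the localization at `F`. -/
def locCoord (h : IsMonomialCoord ℳ T κ) (F : Finset (Fin n)) (z : Loc k M F) :
    (Fin n → ℤ) → k :=
  z.liftOn (fun p α => if α ∈ locSupport T F then κ p.1 (α + intExp (monExp p.2.1)) else 0) <| by
    rintro ⟨m, s, hs⟩ ⟨m', s', hs'⟩ ⟨⟨u, hu⟩, huu⟩
    obtain ⟨B, hB, rfl⟩ := mem_varMonoid_iff.1 hs
    obtain ⟨B', hB', rfl⟩ := mem_varMonoid_iff.1 hs'
    obtain ⟨U, hU, rfl⟩ := mem_varMonoid_iff.1 hu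
    funext α
    split_ifs with hα
    · obtain ⟨C, hC, hCT⟩ := hα
      -- Monomials act by translation only at points of `T`, so both fractions are compared at a
      -- common point far enough out to lie in `T`.
      have hmem : α + intExp (C + U + B' + B) ∈ T := by
        refine hCT _ ?_ ?_
        · exact support_add_subset (support_add_subset (support_add_subset hC hU) hB') hB
        · intro j; simp; omega
      simp only [monExp_monomial]
      simp only [Submonoid.smul_def] at huu
      have h1 := h.smul (C + U + B') m hmem
      have h2 := h.smul (C + U + B) m' hmem
      have h3 : (monomial (C + U + B') (1 : k)) • m = (monomial (C + U + B) (1 : k)) • m' := by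
        simp only [monomial_add_smul]
        rw [huu]
      rw [h3, h2] at h1
      convert h1.symm using 2
      · simp only [intExp_add]; abel
      · simp only [intExp_add]; abel
    · rfl

variable (h : IsMonomialCoord ℳ T κ)
include h

open Classical in
theorem locCoord_mk {F : Finset (Fin n)} (m : M) {B : Fin n →₀ ℕ}
    (hB : monomial B (1 : k) ∈ varMonoid k F) (α : Fin n → ℤ) :
    h.locCoord F (LocalizedModule.mk m ⟨monomial B 1, hB⟩) α =
      if α ∈ locSupport T F then κ m (α + intExp B) else 0 := by
  rw [locCoord, LocalizedModule.liftOn_mk]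
  simp only [monExp_monomial]


theorem mem_locSupport_of_locCoord_ne_zero {F : Finset (Fin n)} {z : Loc k M F} {α : Fin n → ℤ}
    (hz : h.locCoord F z α ≠ 0) : α ∈ locSupport T F := by
  induction z using LocalizedModule.induction_on with
  | h m s =>
    obtain ⟨s, hs⟩ := s
    obtain ⟨B, hB, rfl⟩ := mem_varMonoid_iff.1 hs
    rw [locCoord_mk] at hz
    by_contra h0
    exact hz (if_neg h0)

/-- Extends the translation rule to points that may lie outside `T`. If the target is outside, the
left side is zero; a nonzero right side would place the target between two points of `T`, against
order-connectedness. -/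
theorem coord_smul_of_mem_locSupport {F : Finset (Fin n)} {α : Fin n → ℤ}
    (hα : α ∈ locSupport T F) (m : M) {B B' : Fin n →₀ ℕ} (hB : B.support ⊆ F)
    (hB' : B'.support ⊆ F) :
    κ (monomial B' (1 : k) • m) (α + intExp (B + B')) = κ m (α + intExp B) := by
  by_cases hT : α + intExp (B + B') ∈ T
  · rw [h.smul B' m hT, intExp_add, ← add_assoc, add_sub_cancel_right]
  · have h1 : κ (monomial B' (1 : k) • m) (α + intExp (B + B')) = 0 := by
      by_contra h0
      exact hT (h.mem_of_ne_zero h0)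
    rw [h1]
    by_contra h0
    obtain ⟨C, hC, hCT⟩ := hα
    refine hT (h.ordConnected.out (h.mem_of_ne_zero (Ne.symm h0))
      (hCT (C + B + B') (support_add_subset (support_add_subset hC hB) hB') ?_) ⟨?_, ?_⟩)
    · intro j; simp [add_assoc]
    · intro j; simp
    · intro j; simp

theorem locCoord_add {F : Finset (Fin n)} (z z' : Loc k M F) :
    h.locCoord F (z + z') = h.locCoord F z + h.locCoord F z' := by
  induction z, z' using LocalizedModule.induction_on₂ with
  | h m m' s s' =>
    obtain ⟨s, hs⟩ := s
    obtain ⟨s', hs'⟩ := s'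
    obtain ⟨B, hB, rfl⟩ := mem_varMonoid_iff.1 hs
    obtain ⟨B', hB', rfl⟩ := mem_varMonoid_iff.1 hs'
    funext α
    have hBB : monomial (B + B') (1 : k) ∈ varMonoid k F :=
      mem_varMonoid_iff.2 ⟨_, support_add_subset hB hB', rfl⟩
    have h1 : (⟨monomial B 1, hs⟩ * ⟨monomial B' 1, hs'⟩ : varMonoid k F) =
        ⟨monomial (B + B') 1, hBB⟩ := by
      ext1; simp [monomial_mul]
    rw [LocalizedModule.mk_add_mk, h1, Pi.add_apply, locCoord_mk, locCoord_mk, locCoord_mk]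
    split_ifs with hα
    · simp only [Submonoid.smul_def]
      rw [map_add, Pi.add_apply, h.coord_smul_of_mem_locSupport hα m hB hB', add_comm B B',
        h.coord_smul_of_mem_locSupport hα m' hB' hB]
    · simp

/-- The coordinates on the localization at `F`, as an additive map. -/
def locHom (F : Finset (Fin n)) : Loc k M F →+ ((Fin n → ℤ) → k) :=
  AddMonoidHom.mk' (h.locCoord F) h.locCoord_add

open Classical in
theorem locHom_mk {F : Finset (Fin n)} (m : M) {B : Fin n →₀ ℕ}
    (hB : monomial B (1 : k) ∈ varMonoid k F) (α : Fin n → ℤ) :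
    h.locHom F (LocalizedModule.mk m ⟨monomial B 1, hB⟩) α =
      if α ∈ locSupport T F then κ m (α + intExp B) else 0 := h.locCoord_mk m hB α

theorem mem_locSupport_of_locHom_ne_zero {F : Finset (Fin n)} {z : Loc k M F} {α : Fin n → ℤ}
    (hz : h.locHom F z α ≠ 0) : α ∈ locSupport T F :=
  h.mem_locSupport_of_locCoord_ne_zero hz

theorem locHom_finite {F : Finset (Fin n)} (z : Loc k M F) :
    (Function.support (h.locHom F z)).Finite := by
  induction z using LocalizedModule.induction_on with
  | h m s =>
    obtain ⟨s, hs⟩ := s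
    obtain ⟨B, hB, rfl⟩ := mem_varMonoid_iff.1 hs
    refine ((h.finite m).image (fun α => α - intExp B)).subset ?_
    intro α hα
    rw [Function.mem_support, locHom_mk] at hα
    refine ⟨α + intExp B, ?_, by simp⟩
    intro h0
    simp [h0] at hα

theorem locHom_injective (F : Finset (Fin n)) : Function.Injective (h.locHom F) := by
  rw [injective_iff_map_eq_zero]
  intro z hz
  induction z using LocalizedModule.induction_on with
  | h m s =>
    obtain ⟨s, hs⟩ := s
    obtain ⟨B, hB, rfl⟩ := mem_varMonoid_iff.1 hs
    -- A support point of `m` whose coordinate dies in the localization is translated out of `T` by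
    -- some exponent on `F`; by order-connectedness all larger exponents keep it outside.
    have key : ∀ A : Fin n → ℤ, ∃ C : Fin n →₀ ℕ, C.support ⊆ F ∧ (κ m A ≠ 0 →
        ∀ C' : Fin n →₀ ℕ, C ≤ C' → A + intExp C' ∉ T) := by
      intro A
      by_cases hA : κ m A = 0
      · exact ⟨0, by simp, fun h0 => absurd hA h0⟩
      have hAT := h.mem_of_ne_zero hA
      have h1 := congrFun hz (A - intExp B)
      rw [locHom_mk, sub_add_cancel] at h1
      have h2 : A - intExp B ∉ locSupport T F := by
        intro h2
        rw [if_pos h2] at h1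
        exact hA h1
      have h3 : ∃ C' : Fin n →₀ ℕ, C'.support ⊆ F ∧ B ≤ C' ∧ A - intExp B + intExp C' ∉ T := by
        by_contra! h3
        exact h2 ⟨B, hB, h3⟩
      obtain ⟨C', hC', hBC, hCT⟩ := h3
      refine ⟨C' - B, (Finsupp.support_mono tsub_le_self).trans hC', fun _ C'' hC'' h4 => hCT ?_⟩
      have h5 : A - intExp B + intExp C' = A + intExp (C' - B) := by
        rw [intExp_sub_of_le hBC]; abel
      rw [h5]
      refine h.ordConnected.out hAT h4 ⟨?_, ?_⟩
      · intro j; simp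
      · intro j
        have := hC'' j
        simp only [Pi.add_apply, intExp_apply]
        omega
    choose C hC hCT using key
    -- The sum dominates each of the finitely many thresholds, so `x^D` annihilates `m`.
    set D : Fin n →₀ ℕ := ∑ A ∈ (h.finite m).toFinset, C A with hD
    have hDF : D.support ⊆ F := by
      rw [hD]
      refine Finset.sum_induction _ (fun C : Fin n →₀ ℕ => C.support ⊆ F)
        (fun _ _ => support_add_subset) (by simp) fun A _ => hC A
    have h0 : monomial D (1 : k) • m = 0 := by
      apply h.injective
      rw [map_zero]
      funext γ
      by_contra hne
      have hγ := h.mem_of_ne_zero hne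
      rw [h.smul D m hγ] at hne
      refine hCT _ hne D ?_ (by rwa [sub_add_cancel])
      rw [hD]
      exact Finset.single_le_sum (f := C) (fun _ _ => zero_le) (by simpa using hne)
    rw [← LocalizedModule.zero_mk ⟨monomial B 1, hs⟩, LocalizedModule.mk_eq]
    refine ⟨⟨monomial D 1, mem_varMonoid_iff.2 ⟨D, hDF, rfl⟩⟩, ?_⟩
    simp only [Submonoid.smul_def]
    rw [smul_comm, h0]
    simp only [smul_zero]

theorem sum_eq_of_mem_locPart {F : Finset (Fin n)} {d : ℤ} {z : Loc k M F}
    (hz : z ∈ locPart ℳ F d) {α : Fin n → ℤ} (hα : h.locHom F z α ≠ 0) : ∑ j, α j = d := by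
  induction hz using AddSubgroup.closure_induction with
  | mem z hz =>
    obtain ⟨m, ⟨s, hs⟩, e, he, hm, rfl⟩ := hz
    obtain ⟨B, hB, rfl⟩ := mem_varMonoid_iff.1 hs
    rw [locHom_mk] at hα
    have h1 : κ m (α + intExp B) ≠ 0 := by
      intro h0; simp [h0] at hα
    have h2 := (h.mem_iff m _).1 hm _ h1
    have h3 : B.degree = e := by
      have := he (d := B) (by simp)
      rw [← this, Finsupp.degree_eq_weight_one]
      rfl
    simp only [Pi.add_apply, Finset.sum_add_distrib, sum_intExp, h3] at h2
    omega
  | zero => simp at hα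
  | add x y _ _ hx hy =>
    rw [map_add, Pi.add_apply] at hα
    by_cases h1 : h.locHom F x α = 0
    · exact hy (by simpa [h1] using hα)
    · exact hx h1
  | neg x _ hx => exact hx (by simpa using hα)

/-- Finite support allows one common denominator `x^D` that moves every support point into `T`. -/
theorem exists_mem_locPart {F : Finset (Fin n)} {d : ℤ} (f : (Fin n → ℤ) → k)
    (hf : (Function.support f).Finite)
    (hfT : ∀ α, f α ≠ 0 → α ∈ locSupport T F ∧ ∑ j, α j = d) :
    ∃ z ∈ locPart ℳ F d, h.locHom F z = f := by
  have key : ∀ α : Fin n → ℤ, ∃ C : Fin n →₀ ℕ, C.support ⊆ F ∧ (f α ≠ 0 →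
      ∀ C' : Fin n →₀ ℕ, C'.support ⊆ F → C ≤ C' → α + intExp C' ∈ T) := by
    intro α
    by_cases hα : f α = 0
    · exact ⟨0, by simp, fun h0 => absurd hα h0⟩
    · obtain ⟨C, hC, hCT⟩ := (hfT α hα).1
      exact ⟨C, hC, fun _ => hCT⟩
  choose C hC hCT using key
  set D : Fin n →₀ ℕ := ∑ A ∈ hf.toFinset, C A with hD
  have hDF : D.support ⊆ F := by
    rw [hD]
    refine Finset.sum_induction _ (fun C : Fin n →₀ ℕ => C.support ⊆ F)
      (fun _ _ => support_add_subset) (by simp) fun A _ => hC A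
  obtain ⟨m, hm⟩ := h.exists_of_support (fun α => f (α - intExp D))
    ((hf.image (fun α => α + intExp D)).subset fun α hα => ⟨α - intExp D, hα, by simp⟩) <| by
      intro α hα
      have h1 := hCT _ hα D hDF (by
        rw [hD]
        exact Finset.single_le_sum (f := C) (fun _ _ => zero_le) (by simpa using hα))
      rwa [sub_add_cancel] at h1
  have hDv : monomial D (1 : k) ∈ varMonoid k F := mem_varMonoid_iff.2 ⟨D, hDF, rfl⟩
  refine ⟨LocalizedModule.mk m ⟨monomial D 1, hDv⟩, AddSubgroup.subset_closure
    ⟨m, ⟨monomial D 1, hDv⟩, D.degree, isHomogeneous_monomial _ rfl, ?_, rfl⟩, ?_⟩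
  · rw [h.mem_iff]
    intro α hα
    rw [hm] at hα
    have h1 := (hfT _ hα).2
    simp only [Pi.sub_apply, Finset.sum_sub_distrib, sum_intExp] at h1
    omega
  · funext α
    rw [locHom_mk, hm]
    simp only [add_sub_cancel_right]
    split_ifs with hα
    · rfl
    · by_contra h0
      exact hα (hfT _ (Ne.symm h0)).1

open Classical in
theorem locHom_locMap {F G : Finset (Fin n)} (hFG : F ⊆ G) (z : Loc k M F) (α : Fin n → ℤ) :
    h.locHom G (locMap k M hFG z) α = if α ∈ locSupport T G then h.locHom F z α else 0 := by
  induction z using LocalizedModule.induction_on with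
  | h m s =>
    obtain ⟨s, hs⟩ := s
    obtain ⟨B, hB, rfl⟩ := mem_varMonoid_iff.1 hs
    have h1 : locMap k M hFG (LocalizedModule.mk m ⟨monomial B 1, hs⟩) =
        LocalizedModule.mk m ⟨monomial B 1, varMonoid_mono k hFG hs⟩ := by
      rw [locMap, IsLocalizedModule.mk_eq_mk', IsLocalizedModule.liftOfLE_mk',
        IsLocalizedModule.mk_eq_mk']
    rw [h1, locHom_mk, locHom_mk]
    by_cases hα : α ∈ locSupport T G
    swap
    · rw [if_neg hα, if_neg hα]
    rw [if_pos hα, if_pos hα]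
    split_ifs with hF
    · rfl
    by_contra h0
    refine hF ⟨B, hB, fun C' hC' hBC => ?_⟩
    obtain ⟨C, hC, hCT⟩ := hα
    refine h.ordConnected.out (h.mem_of_ne_zero h0)
      (hCT (C + C') (support_add_subset hC (hC'.trans hFG)) (by intro j; simp)) ⟨?_, ?_⟩
    · intro j
      have := hBC j
      simp; omega
    · intro j; simp

theorem locHom_neg_one_pow_smul {F : Finset (Fin n)} (e : ℕ) (z : Loc k M F) (α : Fin n → ℤ) :
    h.locHom F ((-1 : MvPolynomial (Fin n) k) ^ e • z) α = (-1) ^ e * h.locHom F z α := by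
  rcases Nat.even_or_odd e with he | he
  · simp [he.neg_one_pow]
  · simp [he.neg_one_pow]

/-- Restriction to one multidegree turns the Čech differential into the truncated alternating one;
this separates the strands. -/
theorem locHom_cechD (c : ∀ F : Finset (Fin n), Loc k M F) (F : Finset (Fin n)) (α : Fin n → ℤ) :
    h.locHom F (cechD k n M c F) α =
      diffOn {F | α ∈ locSupport T F} (fun F => h.locHom F (c F) α) F := by
  have h1 : cechD k n M c F = ∑ j ∈ F, (-1 : MvPolynomial (Fin n) k) ^
      (F.filter (fun l => l < j)).card • locMap k M (Finset.erase_subset j F) (c (F.erase j)) := by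
    simp [cechD]
  rw [h1, map_sum, Finset.sum_apply]
  by_cases hF : α ∈ locSupport T F
  · rw [diffOn_of_mem (show F ∈ {F | α ∈ locSupport T F} from hF)]
    refine Finset.sum_congr rfl fun j hj => ?_
    rw [locHom_neg_one_pow_smul, locHom_locMap, if_pos hF]
    rfl
  · rw [diffOn_of_notMem (show F ∉ {F | α ∈ locSupport T F} from hF)]
    refine Finset.sum_eq_zero fun j hj => ?_
    rw [locHom_neg_one_pow_smul, locHom_locMap, if_neg hF, mul_zero]

/-- Strand by strand: a cocycle on one strand lifts to a Čech cocycle concentrated in that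
multidegree, and primitives on the strands glue because only finitely many strands are involved. -/
theorem cocycles_le_coboundaries_iff (i : ℕ) (d : ℤ) :
    cechCocycles (k := k) (n := n) ℳ i d ≤ cechCoboundaries ℳ i d ↔
      ∀ α : Fin n → ℤ, ∑ j, α j = d → ExactAt k {F | α ∈ locSupport T F} i := by
  constructor
  · intro hle α hα c hc hd
    have hex : ∀ F, ∃ z ∈ locPart ℳ F d, h.locHom F z = Pi.single α (c F) := by
      intro F
      refine h.exists_mem_locPart _ ((Set.finite_singleton α).subset ?_) ?_
      · intro β hβ
        by_contra h0
        exact hβ (Pi.single_eq_of_ne h0 _)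
      · intro β hβ
        have : β = α := by
          by_contra h0
          exact hβ (Pi.single_eq_of_ne h0 _)
        subst this
        rw [Pi.single_eq_same] at hβ
        exact ⟨(hc F hβ).1, hα⟩
    choose z hz hzf using hex
    have hzero : ∀ F, c F = 0 → z F = 0 := by
      intro F hF
      apply h.locHom_injective
      rw [hzf, hF, Pi.single_zero, map_zero]
    have hz1 : z ∈ cechCocycles (k := k) (n := n) ℳ i d := by
      refine ⟨fun F => ⟨hz F, fun hF => hzero F ?_⟩, ?_⟩
      · by_contra h0
        exact hF (hc F h0).2
      · change cechD k n M z = 0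
        funext F
        apply h.locHom_injective
        rw [Pi.zero_apply, map_zero]
        funext β
        rw [locHom_cechD]
        by_cases hβ : β = α
        · subst hβ
          simp only [hzf, Pi.single_eq_same]
          exact congrFun hd F
        · simp only [hzf, Pi.single_eq_of_ne hβ]
          exact congrFun (diffOn_zero _) F
    have hz2 := hle hz1
    have hcz : ∀ F, c F = h.locHom F (z F) α := fun F => by rw [hzf, Pi.single_eq_same]
    cases i with
    | zero =>
      have hz3 : z = 0 := hz2
      funext F
      rw [hcz, hz3]
      simp
    | succ i =>
      obtain ⟨y, hy, hyz⟩ := hz2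
      refine ⟨fun F => h.locHom F (y F) α, fun F hF =>
        ⟨h.mem_locSupport_of_locHom_ne_zero hF, ?_⟩, ?_⟩
      · by_contra h0
        refine hF ?_
        beta_reduce
        rw [(hy F).2 h0]
        simp
      · funext F
        rw [← locHom_cechD, hcz, ← hyz]
        rfl
  · intro hex c hc
    obtain ⟨hc1, hc2⟩ := hc
    replace hc2 : cechD k n M c = 0 := hc2
    have hcob : ∀ α : Fin n → ℤ, ∑ j, α j = d →
        IsCoboundaryOn {F | α ∈ locSupport T F} i (fun F => h.locHom F (c F) α) := by
      intro α hα
      refine hex α hα _ (fun F hF => ⟨h.mem_locSupport_of_locHom_ne_zero hF, ?_⟩) ?_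
      · by_contra h0
        rw [(hc1 F).2 h0] at hF
        simp at hF
      · funext F
        rw [← locHom_cechD, hc2]
        simp
    cases i with
    | zero =>
      change c = 0
      funext F
      apply h.locHom_injective
      rw [Pi.zero_apply, map_zero]
      funext α
      by_contra h0
      exact h0 (congrFun (hcob α (h.sum_eq_of_mem_locPart (hc1 F).1 h0)) F)
    | succ i =>
      -- Primitives are taken to be zero wherever the cocycle vanishes, so that the glued cochain
      -- has finite support and stays in degree `d`.
      have hb : ∀ α : Fin n → ℤ, ∃ b : Finset (Fin n) → k,
          IsCochainOn {F | α ∈ locSupport T F} i b ∧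
          diffOn {F | α ∈ locSupport T F} b = (fun F => h.locHom F (c F) α) ∧
          ((∀ F, h.locHom F (c F) α = 0) → b = 0) ∧ (b ≠ 0 → ∑ j, α j = d) := by
        intro α
        by_cases h0 : ∀ F, h.locHom F (c F) α = 0
        · refine ⟨0, fun F hF => absurd rfl hF, ?_, fun _ => rfl, fun h1 => absurd rfl h1⟩
          rw [diffOn_zero]
          funext F
          exact (h0 F).symm
        · obtain ⟨F, hF⟩ := not_forall.1 h0
          have hα := h.sum_eq_of_mem_locPart (hc1 F).1 hF
          obtain ⟨b, hb1, hb2⟩ := hcob α hα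
          exact ⟨b, hb1, hb2, fun h1 => absurd h1 h0, fun _ => hα⟩
      choose b hb1 hb2 hb3 hb4 using hb
      have hy : ∀ F, ∃ y ∈ locPart ℳ F d, h.locHom F y = fun α => b α F := by
        intro F
        refine h.exists_mem_locPart _ ?_ ?_
        · refine (Set.finite_iUnion fun G : Finset (Fin n) => h.locHom_finite (c G)).subset ?_
          intro α hα
          rw [Set.mem_iUnion]
          by_contra! h0
          refine hα ?_
          beta_reduce
          rw [hb3 α fun G => by simpa using h0 G]
          rfl
        · intro α hα
          exact ⟨(hb1 α F hα).1, hb4 α fun h0 => hα (congrFun h0 F)⟩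
      choose y hy1 hy2 using hy
      refine ⟨y, fun F => ⟨hy1 F, fun hF => ?_⟩, ?_⟩
      · apply h.locHom_injective
        rw [hy2, map_zero]
        funext α
        by_contra h0
        exact hF (hb1 α F h0).2
      · change cechD k n M y = c
        funext F
        apply h.locHom_injective
        funext α
        rw [locHom_cechD]
        simp only [hy2]
        exact congrFun (hb2 α) F

theorem nontrivial_localCohomologyPart_iff (i : ℕ) (d : ℤ) :
    Nontrivial (LocalCohomologyPart (k := k) (n := n) ℳ i d) ↔
      ∃ α : Fin n → ℤ, ∑ j, α j = d ∧ ¬ ExactAt k {F | α ∈ locSupport T F} i := by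
  rw [QuotientAddGroup.nontrivial_iff, Ne, AddSubgroup.addSubgroupOf_eq_top,
    h.cocycles_le_coboundaries_iff]
  push Not
  rfl

end IsMonomialCoord

end Coordinates

/-! ### Coordinates on a monomial ideal and on its quotient -/

section MonomialIdeals

variable {k : Type*} [Field k] {n : ℕ}

/-- The truncation of an integer vector to an exponent vector. -/
def natExp (α : Fin n → ℤ) : Fin n →₀ ℕ := Finsupp.equivFunOnFinite.symm fun j => (α j).toNat

@[simp] theorem natExp_apply (α : Fin n → ℤ) (j : Fin n) : natExp α j = (α j).toNat := rfl

theorem intExp_nonneg (A : Fin n →₀ ℕ) : 0 ≤ intExp A := fun j => by simp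

theorem natExp_intExp (A : Fin n →₀ ℕ) : natExp (intExp A) = A := by
  ext j; simp

theorem intExp_natExp {α : Fin n → ℤ} (h : 0 ≤ α) : intExp (natExp α) = α := by
  funext j
  have := h j
  simpa using this

open Classical in
/-- The coefficients of a polynomial, indexed by integer vectors. -/
def polyCoord (k : Type*) [Field k] (n : ℕ) : MvPolynomial (Fin n) k →+ ((Fin n → ℤ) → k) :=
  AddMonoidHom.mk' (fun p α => if 0 ≤ α then coeff (natExp α) p else 0) fun p q => by
    funext α
    rw [Pi.add_apply]
    split_ifs <;> simp

open Classical in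
theorem polyCoord_apply (p : MvPolynomial (Fin n) k) (α : Fin n → ℤ) :
    polyCoord k n p α = if 0 ≤ α then coeff (natExp α) p else 0 := rfl

theorem polyCoord_intExp (p : MvPolynomial (Fin n) k) (A : Fin n →₀ ℕ) :
    polyCoord k n p (intExp A) = coeff A p := by
  rw [polyCoord_apply, if_pos (intExp_nonneg A), natExp_intExp]

theorem nonneg_of_polyCoord_ne_zero {p : MvPolynomial (Fin n) k} {α : Fin n → ℤ}
    (h : polyCoord k n p α ≠ 0) : 0 ≤ α := by
  by_contra h0
  exact h (if_neg h0)

theorem polyCoord_injective : Function.Injective (polyCoord k n) := by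
  intro p q h
  ext A
  rw [← polyCoord_intExp, h, polyCoord_intExp]

theorem polyCoord_finite (p : MvPolynomial (Fin n) k) :
    (Function.support (polyCoord k n p)).Finite := by
  refine ((p.support.finite_toSet).image intExp).subset fun α hα => ?_
  have h0 := nonneg_of_polyCoord_ne_zero hα
  refine ⟨natExp α, ?_, intExp_natExp h0⟩
  rw [Function.mem_support, polyCoord_apply, if_pos h0] at hα
  simpa using hα

theorem exists_polyCoord_eq (f : (Fin n → ℤ) → k) (hf : (Function.support f).Finite)
    (h : ∀ α, f α ≠ 0 → 0 ≤ α) : ∃ p, polyCoord k n p = f := by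
  refine ⟨∑ α ∈ hf.toFinset, monomial (natExp α) (f α), ?_⟩
  funext β
  rw [polyCoord_apply]
  split_ifs with hβ
  · rw [coeff_sum]
    simp only [coeff_monomial]
    by_cases hβ0 : f β = 0
    · rw [hβ0]
      refine Finset.sum_eq_zero fun α hα => ?_
      rw [if_neg]
      intro h1
      have h2 : f α ≠ 0 := by simpa using hα
      rw [← intExp_natExp (h α h2), h1, intExp_natExp hβ] at h2
      exact h2 hβ0
    · rw [Finset.sum_eq_single_of_mem β (by simpa using hβ0), if_pos rfl]
      intro α hα hne
      rw [if_neg]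
      intro h1
      have h2 : f α ≠ 0 := by simpa using hα
      rw [← intExp_natExp (h α h2), h1, intExp_natExp hβ] at hne
      exact hne rfl
  · by_contra h0
    exact hβ (h β (Ne.symm h0))

theorem polyCoord_monomial_mul (B : Fin n →₀ ℕ) (p : MvPolynomial (Fin n) k) {α : Fin n → ℤ}
    (hα : 0 ≤ α) :
    polyCoord k n (monomial B 1 * p) α = polyCoord k n p (α - intExp B) := by
  obtain ⟨A, rfl⟩ : ∃ A, α = intExp A := ⟨_, (intExp_natExp hα).symm⟩
  rw [polyCoord_intExp, coeff_monomial_mul']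
  split_ifs with h
  · rw [← intExp_sub_of_le h, polyCoord_intExp, one_mul]
  · by_contra h0
    refine h (intExp_le.1 ?_)
    exact sub_nonneg.1 (nonneg_of_polyCoord_ne_zero (Ne.symm h0))

theorem mem_polyGrading_iff (p : MvPolynomial (Fin n) k) (d : ℤ) :
    p ∈ polyGrading k n d ↔ ∀ α, polyCoord k n p α ≠ 0 → ∑ j, α j = d := by
  have key : (∀ α, polyCoord k n p α ≠ 0 → ∑ j, α j = d) ↔
      ∀ A, coeff A p ≠ 0 → (A.degree : ℤ) = d := by
    constructor
    · intro h A hA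
      rw [← sum_intExp]
      exact h _ (by rwa [polyCoord_intExp])
    · intro h α hα
      have h0 := nonneg_of_polyCoord_ne_zero hα
      rw [← intExp_natExp h0] at hα ⊢
      rw [polyCoord_intExp] at hα
      rw [sum_intExp]
      exact h _ hα
  rw [key, polyGrading]
  split_ifs with hd
  · change p.IsHomogeneous d.toNat ↔ _
    refine forall_congr' fun A => imp_congr_right fun _ => ?_
    have : Finsupp.weight (1 : Fin n → ℕ) A = A.degree := by
      rw [Finsupp.degree_eq_weight_one]; rfl
    rw [this]
    omega
  · rw [AddSubgroup.mem_bot]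
    constructor
    · rintro rfl A hA
      simp at hA
    · intro h
      ext A
      by_contra h0
      have := h A (by simpa using h0)
      omega

/-- The exponents of the monomials in `I`, as integer vectors. -/
def expSet (I : Ideal (MvPolynomial (Fin n) k)) : Set (Fin n → ℤ) :=
  {α | 0 ≤ α ∧ monomial (natExp α) (1 : k) ∈ I}

theorem intExp_mem_expSet {I : Ideal (MvPolynomial (Fin n) k)} {A : Fin n →₀ ℕ} :
    intExp A ∈ expSet I ↔ monomial A (1 : k) ∈ I := by
  rw [expSet, Set.mem_ofPred_eq, natExp_intExp]
  exact and_iff_right (intExp_nonneg A)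

theorem expSet_isUpperSet (I : Ideal (MvPolynomial (Fin n) k)) : IsUpperSet (expSet I) := by
  rintro α β hαβ ⟨h0, hα⟩
  refine ⟨h0.trans hαβ, ?_⟩
  have h1 : natExp α ≤ natExp β := fun j => Int.toNat_le_toNat (hαβ j)
  have h2 := I.mul_mem_left (monomial (natExp β - natExp α) (1 : k)) hα
  rwa [monomial_mul, one_mul, tsub_add_cancel_of_le h1] at h2

theorem IsMonomialIdeal.mem_iff {I : Ideal (MvPolynomial (Fin n) k)} (hI : IsMonomialIdeal I)
    (p : MvPolynomial (Fin n) k) : p ∈ I ↔ ∀ α, polyCoord k n p α ≠ 0 → α ∈ expSet I := by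
  have key : p ∈ I ↔ ∀ A, coeff A p ≠ 0 → monomial A (1 : k) ∈ I := by
    constructor
    · intro hp A hA
      obtain ⟨s, rfl⟩ := hI
      obtain ⟨B, hB, hBA⟩ := mem_ideal_span_monomial_image.1 hp A (by simpa using hA)
      refine mem_ideal_span_monomial_image.2 fun A' hA' => ⟨B, hB, ?_⟩
      have := support_monomial_subset hA'
      rw [Finset.mem_singleton] at this
      rwa [this]
    · intro h
      rw [p.as_sum]
      refine I.sum_mem fun A hA => ?_
      have h1 := I.mul_mem_left (C (coeff A p)) (h A (by simpa using hA))
      rwa [C_mul_monomial, mul_one] at h1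
  rw [key]
  constructor
  · intro h α hα
    have h0 := nonneg_of_polyCoord_ne_zero hα
    rw [← intExp_natExp h0] at hα ⊢
    rw [polyCoord_intExp] at hα
    exact intExp_mem_expSet.2 (h _ hα)
  · intro h A hA
    exact intExp_mem_expSet.1 (h _ (by rwa [polyCoord_intExp]))

theorem isMonomialCoord_ideal {I : Ideal (MvPolynomial (Fin n) k)} (hI : IsMonomialIdeal I) :
    IsMonomialCoord (k := k) (idealGrading I) (expSet I)
      ((polyCoord k n).comp (Submodule.subtype I).toAddMonoidHom) where
  ordConnected := (expSet_isUpperSet I).ordConnected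
  injective := polyCoord_injective.comp Subtype.val_injective
  finite p := polyCoord_finite p.1
  mem_of_ne_zero {p α} h := (hI.mem_iff p.1).1 p.2 α h
  exists_of_support f hf h := by
    obtain ⟨p, rfl⟩ := exists_polyCoord_eq f hf fun α hα => (h α hα).1
    exact ⟨⟨p, (hI.mem_iff p).2 h⟩, rfl⟩
  smul B p α hα := polyCoord_monomial_mul B p.1 hα.1
  mem_iff p d := mem_polyGrading_iff p.1 d

open Classical in
/-- The coordinates on `S / I` given by the monomials outside `I`. -/
def quotCoord {I : Ideal (MvPolynomial (Fin n) k)} (hI : IsMonomialIdeal I) :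
    (MvPolynomial (Fin n) k ⧸ I) →+ ((Fin n → ℤ) → k) :=
  AddMonoidHom.mk' (fun q α => if α ∈ expSet I then 0 else polyCoord k n q.out α) fun q r => by
    funext α
    rw [Pi.add_apply]
    split_ifs with hα
    · simp
    -- Representatives differ by an element of `I`, which has no coordinates outside `expSet I`.
    · have h1 : (q + r).out - (q.out + r.out) ∈ I := by
        rw [← Ideal.Quotient.eq, map_add]
        simp only [Ideal.Quotient.mk_out]
      have h2 : polyCoord k n ((q + r).out - (q.out + r.out)) α = 0 := by
        by_contra h0
        exact hα ((hI.mem_iff _).1 h1 α h0)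
      simp only [map_sub, map_add, Pi.sub_apply, Pi.add_apply] at h2
      exact sub_eq_zero.1 h2

open Classical in
theorem quotCoord_mk {I : Ideal (MvPolynomial (Fin n) k)} (hI : IsMonomialIdeal I)
    (p : MvPolynomial (Fin n) k) (α : Fin n → ℤ) :
    quotCoord hI (Ideal.Quotient.mk I p) α = if α ∈ expSet I then 0 else polyCoord k n p α := by
  change (if α ∈ expSet I then 0 else polyCoord k n (Ideal.Quotient.mk I p).out α) = _
  split_ifs with hα
  · rfl
  · have h1 : (Ideal.Quotient.mk I p).out - p ∈ I := by
      rw [← Ideal.Quotient.eq, Ideal.Quotient.mk_out]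
    have h2 : polyCoord k n ((Ideal.Quotient.mk I p).out - p) α = 0 := by
      by_contra h0
      exact hα ((hI.mem_iff _).1 h1 α h0)
    simp only [map_sub, Pi.sub_apply] at h2
    exact sub_eq_zero.1 h2

theorem quotCoord_injective {I : Ideal (MvPolynomial (Fin n) k)} (hI : IsMonomialIdeal I) :
    Function.Injective (quotCoord hI) := by
  rw [injective_iff_map_eq_zero]
  intro q hq
  obtain ⟨p, rfl⟩ := Ideal.Quotient.mk_surjective q
  rw [Ideal.Quotient.eq_zero_iff_mem, hI.mem_iff]
  intro α hα
  by_contra h0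
  have h1 := congrFun hq α
  rw [quotCoord_mk, if_neg h0] at h1
  exact hα h1

theorem isMonomialCoord_quot {I : Ideal (MvPolynomial (Fin n) k)} (hI : IsMonomialIdeal I) :
    IsMonomialCoord (k := k) (quotGrading I) {α | 0 ≤ α ∧ α ∉ expSet I} (quotCoord hI) where
  ordConnected := by
    refine ⟨fun α hα β hβ γ hγ => ⟨hα.1.trans hγ.1, fun h => hβ.2 ?_⟩⟩
    exact expSet_isUpperSet I hγ.2 h
  injective := quotCoord_injective hI
  finite q := by
    obtain ⟨p, rfl⟩ := Ideal.Quotient.mk_surjective q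
    refine (polyCoord_finite p).subset fun α hα => ?_
    rw [Function.mem_support, quotCoord_mk] at hα
    intro h0
    simp [h0] at hα
  mem_of_ne_zero {q α} h := by
    obtain ⟨p, rfl⟩ := Ideal.Quotient.mk_surjective q
    rw [quotCoord_mk] at h
    split_ifs at h with hα
    · exact absurd rfl h
    · exact ⟨nonneg_of_polyCoord_ne_zero h, hα⟩
  exists_of_support f hf h := by
    obtain ⟨p, rfl⟩ := exists_polyCoord_eq f hf fun α hα => (h α hα).1
    refine ⟨Ideal.Quotient.mk I p, ?_⟩
    funext α
    rw [quotCoord_mk]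
    split_ifs with hα
    · by_contra h0
      exact (h α (Ne.symm h0)).2 hα
    · rfl
  smul B q α hα := by
    obtain ⟨p, rfl⟩ := Ideal.Quotient.mk_surjective q
    have h1 : monomial B (1 : k) • Ideal.Quotient.mk I p = Ideal.Quotient.mk I (monomial B 1 * p) :=
      rfl
    rw [h1, quotCoord_mk, quotCoord_mk, if_neg hα.2, polyCoord_monomial_mul B p hα.1, if_neg]
    refine fun h0 => hα.2 (expSet_isUpperSet I ?_ h0)
    exact sub_le_self _ (intExp_nonneg B)
  mem_iff q d := by
    constructor
    · rintro ⟨p, hp, rfl⟩ α hα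
      refine (mem_polyGrading_iff p d).1 hp α fun h0 => hα ?_
      change quotCoord hI (Ideal.Quotient.mk I p) α = 0
      rw [quotCoord_mk, h0, ite_self]
    · intro h
      obtain ⟨p, rfl⟩ := Ideal.Quotient.mk_surjective q
      have hz : ∀ α, quotCoord hI (Ideal.Quotient.mk I p) α ≠ 0 →
          α ∉ expSet I ∧ polyCoord k n p α ≠ 0 := by
        intro α hα
        rw [quotCoord_mk] at hα
        split_ifs at hα with h0
        · exact absurd rfl hα
        · exact ⟨h0, hα⟩
      -- `r` is the normal form of `p`: its terms outside `I`. This representative is homogeneous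
      -- even when `p` is not.
      obtain ⟨r, hr⟩ := exists_polyCoord_eq (quotCoord hI (Ideal.Quotient.mk I p))
        ((polyCoord_finite p).subset fun α hα => (hz α hα).2)
        fun α hα => nonneg_of_polyCoord_ne_zero (hz α hα).2
      refine ⟨r, (mem_polyGrading_iff r d).2 (by rwa [hr]), ?_⟩
      apply quotCoord_injective hI
      change quotCoord hI (Ideal.Quotient.mk I r) = _
      funext α
      rw [quotCoord_mk, hr]
      split_ifs with hα
      · by_contra h0
        exact (hz α (Ne.symm h0)).1 hα
      · rfl

end MonomialIdeals

/-! ### Strands of strongly stable ideals -/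

section StronglyStable

variable {n : ℕ}

/-- A strongly stable set of exponents, i.e. the set of exponents of a strongly stable monomial
ideal. -/
structure IsStronglyStable (E : Set (Fin n → ℤ)) : Prop where
  isUpperSet : IsUpperSet E
  nonneg {α : Fin n → ℤ} : α ∈ E → 0 ≤ α
  move_mem {α : Fin n → ℤ} (i j : Fin n) : α ∈ E → i < j → 0 < α j →
    α + Pi.single i 1 - Pi.single j 1 ∈ E

/-- `x^α` enters the ideal with exponents in `E` after inverting the variables from `x_j` on. -/
def Reaches (E : Set (Fin n → ℤ)) (α : Fin n → ℤ) (j : Fin n) : Prop :=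
  ∃ β ∈ E, ∀ l < j, β l ≤ α l

theorem Reaches.anti {E : Set (Fin n → ℤ)} {α : Fin n → ℤ} {i j : Fin n} (hij : i ≤ j)
    (h : Reaches E α j) : Reaches E α i := by
  obtain ⟨β, hβ, hβα⟩ := h
  exact ⟨β, hβ, fun l hl => hβα l (hl.trans_le hij)⟩

/-- Each move from a variable beyond `x_j` to `x_j` lowers the total exponent beyond `j` and leaves
the entries before `j` alone; repeat until nothing remains beyond `j`. -/
theorem IsStronglyStable.exists_truncated {E : Set (Fin n → ℤ)} (hE : IsStronglyStable E)
    (j : Fin n) {β : Fin n → ℤ} (hβ : β ∈ E) :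
    ∃ γ ∈ E, (∀ l < j, γ l = β l) ∧ ∀ l, j < l → γ l = 0 := by
  induction hN : ∑ l ∈ Finset.Ioi j, (β l).toNat using Nat.strong_induction_on generalizing β with
  | _ N ih =>
    by_cases h : ∀ l, j < l → β l = 0
    · exact ⟨β, hβ, fun _ _ => rfl, h⟩
    push Not at h
    obtain ⟨l, hjl, hl⟩ := h
    have hl0 : 0 < β l := lt_of_le_of_ne (hE.nonneg hβ l) (Ne.symm hl)
    obtain ⟨γ, hγ, hγ1, hγ2⟩ := ih _ (by
      rw [← hN]
      refine Finset.sum_lt_sum (fun m hm => ?_) ⟨l, Finset.mem_Ioi.2 hjl, ?_⟩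
      · have hm' := Finset.mem_Ioi.1 hm
        simp only [Pi.sub_apply, Pi.add_apply, Pi.single_eq_of_ne hm'.ne']
        by_cases hml : m = l
        · subst hml; simp
        · simp [Pi.single_eq_of_ne hml]
      · simp only [Pi.sub_apply, Pi.add_apply, Pi.single_eq_of_ne hjl.ne', Pi.single_eq_same]
        omega) (hE.move_mem j l hβ hjl hl0) rfl
    refine ⟨γ, hγ, fun m hm => ?_, hγ2⟩
    rw [hγ1 m hm]
    simp [Pi.single_eq_of_ne hm.ne, Pi.single_eq_of_ne (hm.trans hjl).ne]

theorem IsStronglyStable.mem_locSupport_iff_exists {E : Set (Fin n → ℤ)}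
    (hE : IsStronglyStable E) (α : Fin n → ℤ) (F : Finset (Fin n)) :
    α ∈ locSupport E F ↔ ∃ C : Fin n →₀ ℕ, C.support ⊆ F ∧ α + intExp C ∈ E := by
  constructor
  · rintro ⟨C, hC, h⟩
    exact ⟨C, hC, h C hC le_rfl⟩
  · rintro ⟨C, hC, h⟩
    exact ⟨C, hC, fun C' _ hCC' => hE.isUpperSet (add_le_add_right (intExp_le.2 hCC') α) h⟩

theorem IsStronglyStable.mem_locSupport_compl_iff_forall {E : Set (Fin n → ℤ)}
    (hE : IsStronglyStable E) (α : Fin n → ℤ) (F : Finset (Fin n)) :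
    α ∈ locSupport {α | 0 ≤ α ∧ α ∉ E} F ↔
      (∀ j, α j < 0 → j ∈ F) ∧ ∀ C : Fin n →₀ ℕ, C.support ⊆ F → α + intExp C ∉ E := by
  constructor
  · rintro ⟨C, hC, h⟩
    refine ⟨fun j hj => hC ?_, fun C' hC' hmem => ?_⟩
    · have := (h C hC le_rfl).1 j
      simp only [Pi.zero_apply, Pi.add_apply, intExp_apply] at this
      rw [Finsupp.mem_support_iff]
      omega
    · refine (h (C + C') (support_add_subset hC hC') (by intro j; simp)).2
        (hE.isUpperSet ?_ hmem)
      intro j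
      simp
  -- The exponent `natExp (-α)` clears exactly the negative entries.
  · rintro ⟨hneg, h⟩
    refine ⟨natExp (-α), fun j hj => hneg j ?_, fun C' hC' hle => ⟨fun j => ?_, h C' hC'⟩⟩
    · rw [Finsupp.mem_support_iff, natExp_apply, Pi.neg_apply] at hj
      omega
    · have := hle j
      simp only [natExp_apply, Pi.neg_apply] at this
      simp only [Pi.zero_apply, Pi.add_apply, intExp_apply]
      omega

/-- Forward, take `j` minimal in `F`: the entries before it are untouched. Backward, truncate the
witness at `j`; it can then exceed `α` only at `j` or at negative places of `α`, all of which belong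
to `F`. -/
theorem IsStronglyStable.exists_add_mem_iff {E : Set (Fin n → ℤ)} (hE : IsStronglyStable E)
    {α : Fin n → ℤ} (hα : α ∉ E) {F : Finset (Fin n)} (hF : ∀ j, α j < 0 → j ∈ F) :
    (∃ C : Fin n →₀ ℕ, C.support ⊆ F ∧ α + intExp C ∈ E) ↔ ∃ j ∈ F, Reaches E α j := by
  constructor
  · rintro ⟨C, hC, h⟩
    rcases F.eq_empty_or_nonempty with rfl | hne
    · have : C = 0 := by
        rwa [← Finsupp.support_eq_empty, ← Finset.subset_empty]
      subst this
      refine absurd ?_ hα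
      convert h
      funext j; simp
    · refine ⟨F.min' hne, F.min'_mem hne, _, h, fun l hl => ?_⟩
      have : C l = 0 := by
        by_contra h0
        exact absurd (F.min'_le l (hC (Finsupp.mem_support_iff.2 h0))) (not_le.2 hl)
      simp [this]
  · rintro ⟨j, hj, β, hβ, hβα⟩
    obtain ⟨γ, hγ, hγ1, hγ2⟩ := hE.exists_truncated j hβ
    refine ⟨natExp (γ - α), fun l hl => ?_, hE.isUpperSet ?_ hγ⟩
    · rw [Finsupp.mem_support_iff, natExp_apply, Pi.sub_apply] at hl
      rcases lt_trichotomy l j with hlj | rfl | hlj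
      · have := hβα l hlj
        rw [← hγ1 l hlj] at this
        omega
      · exact hj
      · refine hF l ?_
        have := hγ2 l hlj
        omega
    · intro l
      simp only [Pi.add_apply, intExp_apply, natExp_apply, Pi.sub_apply]
      omega

theorem IsStronglyStable.mem_locSupport_iff {E : Set (Fin n → ℤ)} (hE : IsStronglyStable E)
    {α : Fin n → ℤ} (hα : α ∉ E) (F : Finset (Fin n)) :
    α ∈ locSupport E F ↔ (∀ j, α j < 0 → j ∈ F) ∧ ∃ j ∈ F, Reaches E α j := by
  rw [hE.mem_locSupport_iff_exists]
  by_cases hF : ∀ j, α j < 0 → j ∈ F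
  · rw [hE.exists_add_mem_iff hα hF, and_iff_right hF]
  · refine iff_of_false ?_ fun h => hF h.1
    rintro ⟨C, hC, h⟩
    refine hF fun j hj => hC ?_
    have := hE.nonneg h j
    simp only [Pi.zero_apply, Pi.add_apply, intExp_apply] at this
    rw [Finsupp.mem_support_iff]
    omega

theorem IsStronglyStable.mem_locSupport_compl_iff {E : Set (Fin n → ℤ)}
    (hE : IsStronglyStable E) {α : Fin n → ℤ} (hα : α ∉ E) (F : Finset (Fin n)) :
    α ∈ locSupport {α | 0 ≤ α ∧ α ∉ E} F ↔
      (∀ j, α j < 0 → j ∈ F) ∧ ∀ j ∈ F, ¬ Reaches E α j := by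
  rw [hE.mem_locSupport_compl_iff_forall]
  refine and_congr_right fun hF => ?_
  have := not_congr (hE.exists_add_mem_iff hα hF)
  push Not at this
  exact this

/-- The indices of the negative entries. -/
def negSupport (α : Fin n → ℤ) : Finset (Fin n) := Finset.univ.filter fun j => α j < 0

theorem mem_negSupport {α : Fin n → ℤ} {j : Fin n} : j ∈ negSupport α ↔ α j < 0 := by
  simp [negSupport]

theorem negSupport_subset_iff {α : Fin n → ℤ} {F : Finset (Fin n)} :
    negSupport α ⊆ F ↔ ∀ j, α j < 0 → j ∈ F :=
  forall_congr' fun _ => imp_congr_left mem_negSupport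

/-- `α` contributes to the local cohomology of `S / I`, where `E` is the set of exponents
of `I`. -/
def IsCritical (E : Set (Fin n → ℤ)) (α : Fin n → ℤ) : Prop :=
  α ∉ E ∧ ∀ j, α j < 0 ↔ ¬ Reaches E α j

variable (k : Type*) [Field k]

/-- The family is the interval between the negative places and the non-reaching places. A
non-reaching nonnegative place can be toggled freely, giving acyclicity; a reaching negative place
empties the family; otherwise a single set is left. -/
theorem IsStronglyStable.not_exactAt_compl_iff {E : Set (Fin n → ℤ)} (hE : IsStronglyStable E)
    (α : Fin n → ℤ) (i : ℕ) :
    ¬ ExactAt k {F | α ∈ locSupport {α | 0 ≤ α ∧ α ∉ E} F} i ↔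
      IsCritical E α ∧ i = (negSupport α).card := by
  by_cases hα : α ∈ E
  · refine iff_of_false ?_ fun h => h.1.1 hα
    rw [not_not]
    convert exactAt_empty (k := k) (n := n) i
    refine Set.eq_empty_of_forall_notMem fun F hF => ?_
    refine ((hE.mem_locSupport_compl_iff_forall α F).1 hF).2 0 (by simp) ?_
    convert hα
    funext j; simp
  have hD : {F | α ∈ locSupport {α | 0 ≤ α ∧ α ∉ E} F} =
      {F | negSupport α ⊆ F ∧ ∀ j ∈ F, ¬ Reaches E α j} := by
    ext F
    simp only [Set.mem_ofPred_eq]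
    rw [hE.mem_locSupport_compl_iff hα, negSupport_subset_iff]
  rw [hD]
  by_cases hA : ∃ j, ¬ Reaches E α j ∧ ¬ α j < 0
  · obtain ⟨j, hj, hj'⟩ := hA
    refine iff_of_false ?_ fun h => hj' ((h.1.2 j).2 hj)
    rw [not_not]
    refine exactAt_of_insert j (fun F _ => ?_) i
    simp only [Set.mem_ofPred_eq, Finset.forall_mem_insert, hj, not_false_eq_true, true_and]
    rw [Finset.subset_insert_iff_of_notMem (by rwa [mem_negSupport])]
  push Not at hA
  by_cases hB : ∃ j, Reaches E α j ∧ α j < 0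
  · obtain ⟨j, hj, hj'⟩ := hB
    refine iff_of_false ?_ fun h => (h.1.2 j).1 hj' hj
    rw [not_not]
    convert exactAt_empty (k := k) (n := n) i
    refine Set.eq_empty_of_forall_notMem fun F hF => ?_
    exact hF.2 j (hF.1 (mem_negSupport.2 hj')) hj
  push Not at hB
  have hcrit : IsCritical E α :=
    ⟨hα, fun j => ⟨fun h1 h2 => absurd h1 (not_lt.2 (hB j h2)), hA j⟩⟩
  have hD2 : {F | negSupport α ⊆ F ∧ ∀ j ∈ F, ¬ Reaches E α j} = {negSupport α} := by
    ext F
    simp only [Set.mem_ofPred_eq, Set.mem_singleton_iff]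
    constructor
    · rintro ⟨h1, h2⟩
      exact Finset.Subset.antisymm (fun j hj => mem_negSupport.2 (hA j (h2 j hj))) h1
    · rintro rfl
      exact ⟨Finset.Subset.refl _, fun j hj => (hcrit.2 j).1 (mem_negSupport.1 hj)⟩
  rw [hD2, exactAt_singleton_iff, not_not, and_iff_right hcrit]

/-- Here `F` contains the negative places and must meet the reaching ones. A toggle is again
available at a non-reaching nonnegative place. If a negative place reaches, only the superset
condition remains, which has cohomology only when every entry is negative. In the critical case `F`
ranges over the strict supersets of the negative places. -/
theorem IsStronglyStable.not_exactAt_iff {E : Set (Fin n → ℤ)} (hE : IsStronglyStable E)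
    (hne : E.Nonempty) (hn : 0 < n) (α : Fin n → ℤ) (i : ℕ) :
    ¬ ExactAt k {F | α ∈ locSupport E F} i ↔
      (IsCritical E α ∧ i = (negSupport α).card + 1) ∨ (negSupport α = Finset.univ ∧ i = n) := by
  have hR0 : Reaches E α ⟨0, hn⟩ := by
    obtain ⟨β, hβ⟩ := hne
    refine ⟨β, hβ, fun l hl => absurd hl ?_⟩
    rw [Fin.lt_def]
    simp
  by_cases hα : α ∈ E
  · refine iff_of_false ?_ ?_
    · rw [not_not]
      have huniv : ∀ F, α ∈ locSupport E F := fun F =>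
        (hE.mem_locSupport_iff_exists α F).2 ⟨0, by simp, by
          convert hα
          funext j; simp⟩
      exact exactAt_of_insert ⟨0, hn⟩ (fun F _ => iff_of_true (huniv _) (huniv _)) i
    · rintro (h | h)
      · exact h.1.1 hα
      · have h1 : (⟨0, hn⟩ : Fin n) ∈ negSupport α := by rw [h.1]; exact Finset.mem_univ _
        exact absurd (hE.nonneg hα _) (not_le.2 (mem_negSupport.1 h1))
  have hD : {F | α ∈ locSupport E F} =
      {F | negSupport α ⊆ F ∧ ∃ j ∈ F, Reaches E α j} := by
    ext F
    simp only [Set.mem_ofPred_eq]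
    rw [hE.mem_locSupport_iff hα, negSupport_subset_iff]
  rw [hD]
  by_cases hA : ∃ j, ¬ Reaches E α j ∧ ¬ α j < 0
  · obtain ⟨j, hj, hj'⟩ := hA
    refine iff_of_false ?_ ?_
    · rw [not_not]
      refine exactAt_of_insert j (fun F _ => ?_) i
      simp only [Set.mem_ofPred_eq, Finset.exists_mem_insert, hj, false_or]
      rw [Finset.subset_insert_iff_of_notMem (by rwa [mem_negSupport])]
    · rintro (h | h)
      · exact hj' ((h.1.2 j).2 hj)
      · exact hj' (mem_negSupport.1 (h.1 ▸ Finset.mem_univ j))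
  push Not at hA
  by_cases hB : ∃ j, Reaches E α j ∧ α j < 0
  · obtain ⟨j, hj, hj'⟩ := hB
    have hD2 : {F | negSupport α ⊆ F ∧ ∃ j ∈ F, Reaches E α j} = {F | negSupport α ⊆ F} := by
      ext F
      simp only [Set.mem_ofPred_eq, and_iff_left_iff_imp]
      exact fun h => ⟨j, h (mem_negSupport.2 hj'), hj⟩
    have hnc : ¬ IsCritical E α := fun h => (h.2 j).1 hj' hj
    rw [hD2, or_iff_right fun h => hnc h.1]
    by_cases hG : negSupport α = Finset.univ
    · have hD3 : {F | negSupport α ⊆ F} = {Finset.univ} := by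
        ext F
        simp [hG, Finset.univ_subset_iff]
      rw [hD3, exactAt_singleton_iff, not_not, and_iff_right hG, Finset.card_univ,
        Fintype.card_fin]
    · refine iff_of_false ?_ fun h => hG h.1
      rw [not_not]
      exact exactAt_superset hG i
  push Not at hB
  have hcrit : IsCritical E α :=
    ⟨hα, fun j => ⟨fun h1 h2 => absurd h1 (not_lt.2 (hB j h2)), hA j⟩⟩
  have hG : negSupport α ≠ Finset.univ := fun h =>
    (hcrit.2 ⟨0, hn⟩).1 (mem_negSupport.1 (h ▸ Finset.mem_univ _)) hR0
  have hD2 : {F | negSupport α ⊆ F ∧ ∃ j ∈ F, Reaches E α j} = {F | negSupport α ⊂ F} := by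
    ext F
    have hmem : ∀ j, j ∉ negSupport α ↔ Reaches E α j := fun j => by
      rw [mem_negSupport, hcrit.2 j, not_not]
    constructor
    · rintro ⟨h1, j, hj, hR⟩
      exact (Finset.ssubset_iff_of_subset h1).2 ⟨j, hj, (hmem j).2 hR⟩
    · intro h
      have h1 := (Finset.ssubset_iff_subset_ne.1 h).1
      obtain ⟨j, hj, hj'⟩ := (Finset.ssubset_iff_of_subset h1).1 h
      exact ⟨h1, j, hj, (hmem j).1 hj'⟩
  rw [hD2, exactAt_ssuperset_iff hG, not_not, and_iff_right hcrit, or_iff_left fun h => hG h.1]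

end StronglyStable

/-! ### Borel-fixed ideals in characteristic zero are strongly stable -/

section Borel

variable {k : Type*} [Field k] {n : ℕ}

theorem matAct_transvection_X (i j l : Fin n) :
    matAct (Matrix.transvection i j (1 : k)) (X l) = if l = j then X j + X i else X l := by
  rw [matAct, aeval_X]
  simp only [Matrix.transvection, Matrix.add_apply, map_add, add_mul, Finset.sum_add_distrib]
  have h1 : ∑ x, C ((1 : Matrix (Fin n) (Fin n) k) x l) * X x = (X l : MvPolynomial (Fin n) k) := by
    rw [Finset.sum_eq_single l]
    · simp
    · intro b _ hb
      simp [Matrix.one_apply_ne hb]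
    · simp
  have h2 : ∑ x, C (Matrix.single i j (1 : k) x l) * X x =
      if l = j then (X i : MvPolynomial (Fin n) k) else 0 := by
    rw [Finset.sum_eq_single i]
    · split_ifs with h
      · subst h; simp
      · simp [Matrix.single_apply_of_col_ne _ _ (Ne.symm h)]
    · intro b _ hb
      simp [Matrix.single_apply_of_row_ne hb.symm]
    · simp
  rw [h1, h2]
  split_ifs with h
  · rw [h]
  · rw [add_zero]

/-- The term with a single `X i` has coefficient `a + 1`, which is nonzero in characteristic 0; this
is where the characteristic enters. -/
theorem coeff_X_add_X_pow {i j : Fin n} (hij : i ≠ j) (a : ℕ) :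
    coeff (Finsupp.single i 1 + Finsupp.single j a)
      ((X j + X i : MvPolynomial (Fin n) k) ^ (a + 1)) = (a + 1 : ℕ) := by
  rw [add_pow, coeff_sum, Finset.sum_eq_single_of_mem a (by simp)]
  · have h1 : (X j ^ a * X i ^ (a + 1 - a) * ((a + 1).choose a : MvPolynomial (Fin n) k)) =
        monomial (Finsupp.single i 1 + Finsupp.single j a) ((a + 1 : ℕ) : k) := by
      rw [Nat.choose_succ_self_right, add_tsub_cancel_left, X_pow_eq_monomial, X_pow_eq_monomial,
        monomial_mul, ← map_natCast (C : k →+* MvPolynomial (Fin n) k), mul_comm, C_mul_monomial,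
        add_comm (Finsupp.single j a)]
      simp
    rw [h1, coeff_monomial, if_pos rfl]
  · intro b _ hb
    rw [X_pow_eq_monomial, X_pow_eq_monomial, monomial_mul,
      ← map_natCast (C : k →+* MvPolynomial (Fin n) k), mul_comm, C_mul_monomial, coeff_monomial,
      if_neg]
    intro h
    have := DFunLike.congr_fun h j
    simp [hij.symm] at this
    exact hb this

/-- The upper triangular substitution `x_j ↦ x_j + x_i` sends `x^B x_j^(a+1)` to a polynomial in `I`
containing the term `x^B x_i x_j^a`, and a monomial ideal contains every monomial of its elements.
-/
theorem IsBorelFixed.isStronglyStable [CharZero k] {I : Ideal (MvPolynomial (Fin n) k)}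
    (hI : IsBorelFixed I) : IsStronglyStable (expSet I) where
  isUpperSet := expSet_isUpperSet I
  nonneg h := h.1
  move_mem {α} i j hα hij hj := by
    obtain ⟨A, rfl⟩ : ∃ A, α = intExp A := ⟨_, (intExp_natExp hα.1).symm⟩
    rw [intExp_mem_expSet] at hα
    obtain ⟨a, ha⟩ : ∃ a, A j = a + 1 := ⟨A j - 1, by simp at hj; omega⟩
    set B := A.erase j with hB
    have hA : A = B + Finsupp.single j (a + 1) := by
      rw [← ha, hB, Finsupp.erase_add_single]
    set g : GL (Fin n) k := Matrix.GeneralLinearGroup.mkOfDetNeZero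
      (Matrix.transvection i j (1 : k)) (by rw [Matrix.det_transvection_of_ne _ _ hij.ne]; simp)
    have hg : g.val = Matrix.transvection i j (1 : k) := rfl
    have hmem : matAct g.val (monomial A (1 : k)) ∈ I := by
      have h1 := hI.2 g fun i' j' hij' => by
        rw [hg, Matrix.transvection, Matrix.add_apply, Matrix.one_apply_ne hij'.ne', zero_add]
        by_contra h0
        rw [Matrix.single_apply] at h0
        split_ifs at h0 with h2
        · rw [h2.1, h2.2] at hij
          exact absurd hij hij'.asymm
        · exact h0 rfl
      have h2 : matAct g.val (monomial A (1 : k)) ∈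
          matAct g.val '' (I : Set (MvPolynomial (Fin n) k)) := ⟨_, hα, rfl⟩
      rw [h1] at h2
      exact h2
    have hBact : matAct g.val (monomial B (1 : k)) = monomial B 1 := by
      rw [monomial_eq, C_1, one_mul, Finsupp.prod, map_prod]
      refine Finset.prod_congr rfl fun l hl => ?_
      have : l ≠ j := by
        rintro rfl
        simp [hB] at hl
      rw [map_pow, hg, matAct_transvection_X, if_neg this]
    have hact : matAct g.val (monomial A (1 : k)) = monomial B 1 * (X j + X i) ^ (a + 1) := by
      rw [hA, ← one_mul (1 : k), ← monomial_mul, map_mul, one_mul, hBact, ← X_pow_eq_monomial,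
        map_pow, hg, matAct_transvection_X, if_pos rfl]
    rw [hact] at hmem
    have hmem2 := (hI.1.mem_iff _).1 hmem
      (intExp (B + (Finsupp.single i 1 + Finsupp.single j a))) (by
        rw [polyCoord_intExp, coeff_monomial_mul, coeff_X_add_X_pow hij.ne, one_mul]
        exact_mod_cast Nat.succ_ne_zero a)
    convert hmem2 using 1
    rw [hA]
    funext l
    simp only [Pi.sub_apply, Pi.add_apply, intExp_apply, Finsupp.add_apply, Finsupp.single_apply,
      Pi.single_apply, eq_comm (a := l)]
    split_ifs <;> push_cast <;> omega

end Borel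

/-! ### Critical degrees versus minimal exponents -/

section CriticalDegrees

variable {n : ℕ}

/-- A critical degree yields a minimal exponent whose last index and degree are controlled. -/
theorem IsStronglyStable.exists_minimal_of_isCritical {E : Set (Fin n → ℤ)}
    (hE : IsStronglyStable E) (hne : E.Nonempty) (hn : 0 < n) {α : Fin n → ℤ}
    (hα : IsCritical E α) :
    ∃ γ, Minimal (· ∈ E) γ ∧ ∃ j : Fin n, 0 < γ j ∧ (∀ l, j < l → γ l = 0) ∧
      (j : ℕ) + 1 + (negSupport α).card = n ∧
      ∑ l, α l + (negSupport α).card + 1 ≤ ∑ l, γ l := by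
  classical
  obtain ⟨hαE, hcrit⟩ := hα
  have hR0 : Reaches E α ⟨0, hn⟩ := by
    obtain ⟨β, hβ⟩ := hne
    refine ⟨β, hβ, fun l hl => absurd hl ?_⟩
    rw [Fin.lt_def]
    simp
  set R : Finset (Fin n) := Finset.univ.filter fun j => Reaches E α j with hR
  have hRne : R.Nonempty := ⟨⟨0, hn⟩, by simpa [hR] using hR0⟩
  set j := R.max' hRne with hj
  have hjR : Reaches E α j := by
    have := R.max'_mem hRne
    simpa [hR] using this
  have hmax : ∀ l, j < l → ¬ Reaches E α l := by
    intro l hl h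
    exact absurd (R.le_max' l (by simpa [hR] using h)) (not_le.2 hl)
  have hlt : ∀ l, α l < 0 ↔ j < l := by
    intro l
    rw [hcrit l]
    refine ⟨fun h => ?_, hmax l⟩
    by_contra h0
    exact h (hjR.anti (not_lt.1 h0))
  have hneg : negSupport α = Finset.Ioi j := by
    ext l
    rw [mem_negSupport, hlt, Finset.mem_Ioi]
  -- Truncating a witness that `j` is reached gives such an exponent; below, `N` is the least one.
  have hex : ∃ N : ℕ, (fun l => if l < j then α l else if l = j then (N : ℤ) else 0) ∈ E := by
    obtain ⟨β, hβ, hβα⟩ := hjR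
    obtain ⟨γ, hγ, hγ1, hγ2⟩ := hE.exists_truncated j hβ
    refine ⟨(γ j).toNat, hE.isUpperSet (fun l => ?_) hγ⟩
    rcases lt_trichotomy l j with hl | rfl | hl
    · simp [hl, hγ1 l hl, hβα l hl]
    · simp
    · simp [hl.not_gt, hl.ne', hγ2 l hl]
  set N := Nat.find hex with hN
  set γ : Fin n → ℤ := fun l => if l < j then α l else if l = j then (N : ℤ) else 0 with hγ
  have hγE : γ ∈ E := Nat.find_spec hex
  have hγlt : ∀ l, l < j → γ l = α l := fun l hl => by simp [hγ, hl]
  have hγj : γ j = N := by simp [hγ]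
  have hγgt : ∀ l, j < l → γ l = 0 := fun l hl => by simp [hγ, hl.not_gt, hl.ne']
  -- Otherwise `γ` would witness that `j + 1` is reached, against the choice of `j`, or, when `j` is
  -- the last index, would put `α` into `E`.
  have hNα : α j < N := by
    by_contra! h0
    by_cases h : ∃ l, j < l
    · obtain ⟨l, hl⟩ := h
      have hjn : (j : ℕ) + 1 < n := by
        have := l.isLt
        rw [Fin.lt_def] at hl
        omega
      refine hmax ⟨j + 1, hjn⟩ (by rw [Fin.lt_def]; simp) ⟨γ, hγE, fun m hm => ?_⟩
      have hmj : m ≤ j := by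
        rw [Fin.lt_def] at hm
        rw [Fin.le_def]
        simp only at hm
        omega
      rcases hmj.lt_or_eq with hm | rfl
      · exact (hγlt m hm).le
      · rw [hγj]; exact h0
    · push Not at h
      refine hαE (hE.isUpperSet (fun m => ?_) hγE)
      rcases (h m).lt_or_eq with hm | rfl
      · exact (hγlt m hm).le
      · rw [hγj]; exact h0
  have hαj : 0 ≤ α j := by
    rw [← not_lt, hlt]
    exact lt_irrefl _
  have hpred : γ - Pi.single j 1 ∉ E := by
    intro h
    refine Nat.find_min hex (m := N - 1) (by omega) ?_
    convert h using 1
    funext l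
    rcases lt_trichotomy l j with hl | rfl | hl
    · simp [hl, hγlt l hl, hl.ne]
    · simp [hγj]; omega
    · simp [hl.not_gt, hl.ne', hγgt l hl]
  refine ⟨γ, ⟨hγE, fun β hβ hβγ => ?_⟩, j, by omega, hγgt, ?_, ?_⟩
  · have hβgt : ∀ l, j < l → β l ≤ 0 := fun l hl => (hβγ l).trans (hγgt l hl).le
    have hβj : γ j ≤ β j := by
      by_contra! h0
      refine hpred (hE.isUpperSet (fun l => ?_) hβ)
      rcases eq_or_ne l j with rfl | hl
      · simp; omega
      · simpa [hl] using hβγ l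
    by_contra h0
    obtain ⟨i, hi⟩ : ∃ i, β i < γ i := by
      rw [Pi.le_def] at h0
      push Not at h0
      exact h0
    have hij : i < j := by
      rcases lt_trichotomy i j with h | rfl | h
      · exact h
      · omega
      · have h1 := hE.nonneg hβ i
        rw [hγgt i h] at hi
        simp only [Pi.zero_apply] at h1
        omega
    -- If `β` is strictly smaller at `i < j`, moving a unit from `j` to `i` stays below `γ - e_j`,
    -- which is outside `E`.
    refine hpred (hE.isUpperSet (fun l => ?_) (hE.move_mem i j hβ hij (by omega)))
    have h1 := hβγ l
    rcases eq_or_ne l j with rfl | hl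
    · simpa [hij.ne'] using h1
    · rcases eq_or_ne l i with rfl | hl'
      · simp [hl]; omega
      · simpa [hl, hl'] using h1
  · rw [hneg, Fin.card_Ioi]
    have := j.isLt
    omega
  · have hcard : ((negSupport α).card : ℤ) = ∑ l, if j < l then 1 else 0 := by
      rw [hneg, Finset.sum_boole]
      congr 2
      ext l
      simp
    have hone : (1 : ℤ) = ∑ l, if l = j then 1 else 0 := by simp
    rw [hcard]
    nth_rw 2 [hone]
    rw [← Finset.sum_add_distrib, ← Finset.sum_add_distrib]
    -- Termwise: equality before `j`, the extra 1 is absorbed at `j` since `α j < N`, and after `j`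
    -- each entry is at most `-1`.
    refine Finset.sum_le_sum fun l _ => ?_
    rcases lt_trichotomy l j with hl | rfl | hl
    · simp [hl.not_gt, hl.ne, hγlt l hl]
    · simp [hγj]; omega
    · have := (hlt l).2 hl
      simp [hl, hl.ne', hγgt l hl]; omega

/-- Conversely, a degree just outside `E` yields a critical degree. -/
theorem IsStronglyStable.exists_isCritical {E : Set (Fin n → ℤ)} (hE : IsStronglyStable E)
    (m : ℕ) (j : Fin n) (hm : (j : ℕ) + 1 + m = n) {α : Fin n → ℤ} (h0 : 0 ≤ α) (hα : α ∉ E)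
    (hgt : ∀ l, j < l → α l = 0) (hαj : α + Pi.single j 1 ∈ E) :
    ∃ β, IsCritical E β ∧ (negSupport β).card ≤ m ∧
      ∑ l, α l ≤ ∑ l, β l + (negSupport β).card := by
  classical
  induction m generalizing j α with
  | zero =>
    have hle : ∀ l, l ≤ j := fun l => by
      rw [Fin.le_def]
      have := l.isLt
      omega
    have hneg : negSupport α = ∅ := by
      ext l
      simpa [mem_negSupport] using h0 l
    refine ⟨α, ⟨hα, fun l => iff_of_false (not_lt.2 (h0 l)) ?_⟩, by simp [hneg], by simp [hneg]⟩
    rw [not_not]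
    refine ⟨_, hαj, fun i hi => ?_⟩
    simp [(hi.trans_le (hle l)).ne]
  | succ m ih =>
    have hjn : (j : ℕ) + 1 < n := by omega
    set j' : Fin n := ⟨j + 1, hjn⟩ with hj'
    have hjj' : j < j' := by rw [Fin.lt_def]; simp [hj']
    have hj'le : ∀ l, j < l → j' ≤ l := fun l hl => by
      rw [Fin.lt_def] at hl
      rw [Fin.le_def]
      exact hl
    -- If some power of the next variable enters `E`, stop one short of the least such power and
    -- continue from that variable; otherwise put `-1` at every later place.
    by_cases hex : ∃ N : ℕ, α + Pi.single j' (N : ℤ) ∈ E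
    · have hN := Nat.find_spec hex
      have hN0 : Nat.find hex ≠ 0 := by
        intro h
        rw [h] at hN
        simp at hN
        exact hα hN
      obtain ⟨β, hβ, hβm, hβs⟩ := ih j' (α := α + Pi.single j' ((Nat.find hex - 1 : ℕ) : ℤ))
        (by simp [hj']; omega)
        (add_nonneg h0 (Pi.single_nonneg.2 (by positivity)))
        (Nat.find_min hex (by omega))
        (fun l hl => by simp [hl.ne', hgt l (hjj'.trans hl)])
        (by
          convert hN using 1
          rw [add_assoc, ← Pi.single_add]
          congr 2
          omega)
      refine ⟨β, hβ, hβm.trans (Nat.le_succ m), le_trans (Finset.sum_le_sum fun l _ => ?_) hβs⟩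
      rw [Pi.add_apply]
      have : (0 : Fin n → ℤ) ≤ Pi.single j' ((Nat.find hex - 1 : ℕ) : ℤ) :=
        Pi.single_nonneg.2 (by positivity)
      have := this l
      simp only [Pi.zero_apply] at this
      omega
    · push Not at hex
      set β : Fin n → ℤ := fun l => if l ≤ j then α l else -1 with hβ
      have hβle : ∀ l, l ≤ j → β l = α l := fun l hl => by simp [hβ, hl]
      have hβgt : ∀ l, j < l → β l = -1 := fun l hl => by simp [hβ, hl.not_ge]
      have hlt : ∀ l, β l < 0 ↔ j < l := by
        intro l
        rcases le_or_gt l j with hl | hl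
        · rw [hβle l hl]
          exact iff_of_false (not_lt.2 (h0 l)) hl.not_gt
        · rw [hβgt l hl]
          exact iff_of_true (by omega) hl
      have hneg : negSupport β = Finset.Ioi j := by
        ext l
        rw [mem_negSupport, hlt, Finset.mem_Ioi]
      have hβE : β ∉ E := fun h => by
        have := hE.nonneg h j'
        rw [hβgt j' hjj'] at this
        simp at this
      have hcrit : IsCritical E β := by
        refine ⟨hβE, fun l => ?_⟩
        rw [hlt]
        constructor
        · intro hl h
          -- Reaching any later place would imply reaching `j'`; truncation there makes a power of
          -- `x_{j'}` carry `α` into `E`, which is excluded.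
          obtain ⟨δ, hδ, hδβ⟩ := h.anti (hj'le l hl)
          obtain ⟨γ, hγ, hγ1, hγ2⟩ := hE.exists_truncated j' hδ
          refine hex (γ j').toNat (hE.isUpperSet (fun i => ?_) hγ)
          have h0i := h0 i
          simp only [Pi.zero_apply] at h0i
          rcases lt_trichotomy i j' with hi | rfl | hi
          · have hij : i ≤ j := by
              by_contra h1
              exact absurd (hj'le i (not_le.1 h1)) (not_le.2 hi)
            rw [hγ1 i hi]
            simpa [hi.ne, hβle i hij] using hδβ i hi
          · simp only [Pi.add_apply, Pi.single_eq_same]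
            omega
          · rw [hγ2 i hi]
            simpa [hi.ne'] using h0i
        · intro h
          by_contra h1
          refine h ⟨_, hαj, fun i hi => ?_⟩
          have hij : i < j := hi.trans_le (not_lt.1 h1)
          simp [hij.ne, hβle i hij.le]
      have hcard : (negSupport β).card = m + 1 := by
        rw [hneg, Fin.card_Ioi]
        omega
      refine ⟨β, hcrit, hcard.le, ?_⟩
      have hsum : ((negSupport β).card : ℤ) = ∑ l, if j < l then 1 else 0 := by
        rw [hneg, Finset.sum_boole]
        congr 2
        ext l
        simp
      rw [hsum, ← Finset.sum_add_distrib]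
      refine Finset.sum_le_sum fun l _ => ?_
      rcases le_or_gt l j with hl | hl
      · simp [hβle l hl, hl.not_gt]
      · simp [hβgt l hl, hl, hgt l hl]

end CriticalDegrees

/-! ### Translation to minimal generators -/

section MinimalGenerators

variable {k : Type*} [Field k] {n : ℕ} {I : Ideal (MvPolynomial (Fin n) k)}

theorem minimal_intExp_iff {A : Fin n →₀ ℕ} :
    Minimal (· ∈ expSet I) (intExp A) ↔ IsMinGen I A := by
  constructor
  · intro h
    refine ⟨intExp_mem_expSet.1 h.1, fun B hB hBA => ?_⟩
    exact intExp_le.1 (h.2 (intExp_mem_expSet.2 hB) (intExp_le.2 hBA))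
  · intro h
    refine ⟨intExp_mem_expSet.2 h.1, fun β hβ hβA => ?_⟩
    obtain ⟨B, rfl⟩ : ∃ B, β = intExp B := ⟨_, (intExp_natExp hβ.1).symm⟩
    exact intExp_le.2 (h.2 (intExp_mem_expSet.1 hβ) (intExp_le.1 hβA))

theorem maxIndex_eq {A : Fin n →₀ ℕ} {j : Fin n} (hj : A j ≠ 0) (h : ∀ l, j < l → A l = 0) :
    maxIndex A = j + 1 := by
  refine le_antisymm (Finset.sup_le fun l hl => ?_)
    (Finset.le_sup (f := fun j : Fin n => (j : ℕ) + 1) (Finsupp.mem_support_iff.2 hj))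
  have : l ≤ j := by
    by_contra h0
    exact Finsupp.mem_support_iff.1 hl (h l (not_le.1 h0))
  rw [Fin.le_def] at this
  omega

theorem exists_maxIndex_eq {A : Fin n →₀ ℕ} (hA : A ≠ 0) :
    ∃ j : Fin n, A j ≠ 0 ∧ (∀ l, j < l → A l = 0) ∧ maxIndex A = j + 1 := by
  have hne : A.support.Nonempty := Finsupp.support_nonempty_iff.2 hA
  have h1 : A (A.support.max' hne) ≠ 0 := Finsupp.mem_support_iff.1 (Finset.max'_mem _ _)
  have h2 : ∀ l, A.support.max' hne < l → A l = 0 := fun l hl => by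
    by_contra h0
    exact absurd (A.support.le_max' l (Finsupp.mem_support_iff.2 h0)) (not_le.2 hl)
  exact ⟨_, h1, h2, maxIndex_eq h1 h2⟩

theorem IsMinGen.ne_zero (hI1 : I ≠ ⊤) {A : Fin n →₀ ℕ} (hA : IsMinGen I A) : A ≠ 0 := by
  rintro rfl
  exact hI1 ((Ideal.eq_top_iff_one I).2 hA.1)

/-- By minimality, dividing by the last variable leaves `I`, so `exists_isCritical` applies to `A -
e_j`; the `+ 1` is the degree of the removed variable. -/
theorem IsMinGen.exists_isCritical (hE : IsStronglyStable (expSet I)) (hI1 : I ≠ ⊤)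
    {A : Fin n →₀ ℕ} (hA : IsMinGen I A) :
    ∃ β, IsCritical (expSet I) β ∧ (negSupport β).card + maxIndex A ≤ n ∧
      (A.degree : ℤ) ≤ ∑ l, β l + (negSupport β).card + 1 := by
  obtain ⟨j, hj, hgt, hmax⟩ := exists_maxIndex_eq (hA.ne_zero hI1)
  have hmin := minimal_intExp_iff.2 hA
  have hle : Finsupp.single j 1 ≤ A := by
    rw [Finsupp.single_le_iff]
    omega
  have hsub : intExp (A - Finsupp.single j 1) = intExp A - Pi.single j 1 := by
    rw [intExp_sub_of_le hle]
    congr 1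
    funext l
    simp [Finsupp.single_apply, Pi.single_apply, eq_comm (a := l)]
  obtain ⟨β, hβ, hcard, hsum⟩ := hE.exists_isCritical (n - 1 - j) j (by have := j.isLt; omega)
    (α := intExp A - Pi.single j 1) (hsub ▸ intExp_nonneg _)
    (fun h => by
      have := hmin.2 h (sub_le_self _ (Pi.single_nonneg.2 zero_le_one)) j
      simp at this)
    (fun l hl => by simp [hl.ne', hgt l hl])
    (by rw [sub_add_cancel]; exact hmin.1)
  refine ⟨β, hβ, by have := j.isLt; omega, ?_⟩
  simp only [Pi.sub_apply, Finset.sum_sub_distrib, sum_intExp, Finset.sum_pi_single',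
    Finset.mem_univ, if_true] at hsum
  omega

theorem IsCritical.exists_isMinGen (hE : IsStronglyStable (expSet I)) (hne : (expSet I).Nonempty)
    (hn : 0 < n) {α : Fin n → ℤ} (hα : IsCritical (expSet I) α) :
    ∃ A, IsMinGen I A ∧ maxIndex A + (negSupport α).card = n ∧
      ∑ l, α l + (negSupport α).card + 1 ≤ A.degree := by
  obtain ⟨γ, hγ, j, hj, hgt, hcard, hsum⟩ := hE.exists_minimal_of_isCritical hne hn hα
  obtain ⟨A, rfl⟩ : ∃ A, γ = intExp A := ⟨_, (intExp_natExp hγ.1.1).symm⟩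
  refine ⟨A, minimal_intExp_iff.1 hγ, ?_, by rwa [sum_intExp] at hsum⟩
  rw [maxIndex_eq (j := j) (by rw [intExp_apply] at hj; omega)
    fun l hl => by have := hgt l hl; rw [intExp_apply] at this; omega, hcard]

theorem expSet_nonempty (hI : IsMonomialIdeal I) (hI0 : I ≠ ⊥) : (expSet I).Nonempty := by
  obtain ⟨p, hp, hp0⟩ := Submodule.exists_mem_ne_zero_of_ne_bot hI0
  obtain ⟨A, hA⟩ := ne_zero_iff.1 hp0
  exact ⟨intExp A, (hI.mem_iff p).1 hp _ (by rwa [polyCoord_intExp])⟩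

theorem exists_isMinGen (hne : (expSet I).Nonempty) : ∃ A, IsMinGen I A := by
  obtain ⟨α, hα⟩ := hne
  obtain ⟨A, hA⟩ := exists_minimal_of_wellFoundedLT
    (fun B : Fin n →₀ ℕ => monomial B (1 : k) ∈ I) ⟨_, hα.2⟩
  exact ⟨A, hA⟩

end MinimalGenerators

/-! ### Suprema through their upper bounds -/

section Suprema

theorem toExt_le_toExt {a b : ℤ} : toExt a ≤ toExt b ↔ a ≤ b := by
  simp [toExt]

/-- Adding an integer is invertible on `ExtInt`, including at both infinities. -/
theorem add_toExt_le_iff {x y : ExtInt} {c : ℤ} : x + toExt c ≤ y ↔ x ≤ y + toExt (-c) := by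
  have h : ∀ (x : ExtInt) (c : ℤ), x + toExt c + toExt (-c) = x := by
    intro x c
    rw [add_assoc, toExt, toExt, ← WithBot.coe_add, ← WithTop.coe_add]
    simp
  constructor
  · intro hxy
    rw [← h x c]
    gcongr
  · intro hxy
    have := h y (-c)
    rw [neg_neg] at this
    rw [← this]
    gcongr

theorem toExt_le_add_toExt_iff {d c : ℤ} {y : ExtInt} :
    toExt d ≤ y + toExt (-c) ↔ toExt (d + c) ≤ y := by
  rw [← add_toExt_le_iff, toExt, toExt, toExt, WithTop.coe_add, WithBot.coe_add]

variable {k : Type*} [Field k] {n : ℕ} {M : Type*} [AddCommGroup M]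
    [Module (MvPolynomial (Fin n) k) M] {ℳ : ℤ → AddSubgroup M}

theorem regT_le_iff {t : ℕ} {x : ExtInt} :
    regT k n ℳ t ≤ x ↔ ∀ i ≤ t, ∀ d : ℤ,
      Nontrivial (LocalCohomologyPart (k := k) (n := n) ℳ i d) → toExt (d + i) ≤ x := by
  simp only [regT, iSup_le_iff, Set.mem_ofPred_eq, add_toExt_le_iff, aInv, toExt_le_add_toExt_iff]

theorem aStarT_le_iff {t : ℕ} {x : ExtInt} :
    aStarT k n ℳ t ≤ x ↔ ∀ i ≤ t, ∀ d : ℤ,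
      Nontrivial (LocalCohomologyPart (k := k) (n := n) ℳ i d) → toExt d ≤ x := by
  simp only [aStarT, iSup_le_iff, Set.mem_ofPred_eq, aInv]

end Suprema

/-! ### Nonvanishing local cohomology in terms of critical degrees -/

section LocalCohomologyOfBorelIdeals

variable {k : Type*} [Field k] {n : ℕ} {I : Ideal (MvPolynomial (Fin n) k)}

theorem nontrivial_quot_iff (hI : IsMonomialIdeal I) (hE : IsStronglyStable (expSet I))
    (i : ℕ) (d : ℤ) :
    Nontrivial (LocalCohomologyPart (k := k) (n := n) (quotGrading I) i d) ↔
      ∃ α, ∑ j, α j = d ∧ IsCritical (expSet I) α ∧ i = (negSupport α).card := by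
  rw [(isMonomialCoord_quot hI).nontrivial_localCohomologyPart_iff]
  simp only [hE.not_exactAt_compl_iff k]

theorem nontrivial_ideal_iff (hI : IsMonomialIdeal I) (hE : IsStronglyStable (expSet I))
    (hne : (expSet I).Nonempty) (hn : 0 < n) (i : ℕ) (d : ℤ) :
    Nontrivial (LocalCohomologyPart (k := k) (n := n) (idealGrading I) i d) ↔
      ∃ α, ∑ j, α j = d ∧ ((IsCritical (expSet I) α ∧ i = (negSupport α).card + 1) ∨
        (negSupport α = Finset.univ ∧ i = n)) := by
  rw [(isMonomialCoord_ideal hI).nontrivial_localCohomologyPart_iff]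
  simp only [hE.not_exactAt_iff k hne hn]

theorem sum_le_neg_of_negSupport_eq_univ {α : Fin n → ℤ} (h : negSupport α = Finset.univ) :
    ∑ j, α j ≤ -n := by
  have h1 : ∑ j, α j ≤ ∑ _j : Fin n, (-1 : ℤ) := Finset.sum_le_sum fun j _ => by
    have := mem_negSupport.1 (h ▸ Finset.mem_univ j)
    omega
  simpa using h1

end LocalCohomologyOfBorelIdeals

end BorelCohomology

end

/-! ### Comparison of the invariants with the generators -/

theorem theorem2p4 {k : Type*} [Field k] [CharZero k] {n : ℕ}
    (I : Ideal (MvPolynomial (Fin n) k)) (hI : BorelCohomology.IsBorelFixed I)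
    (hI0 : I ≠ ⊥) (hI1 : I ≠ ⊤) (t : ℕ) :
    (BorelCohomology.regT k n (BorelCohomology.quotGrading I) t + BorelCohomology.toExt 1 =
        ⨆ A ∈ {A : Fin n →₀ ℕ | BorelCohomology.IsMinGen I A ∧
            (n : ℤ) - t ≤ BorelCohomology.maxIndex A},
          BorelCohomology.toExt (A.degree : ℤ)) ∧
    (BorelCohomology.regT k n (BorelCohomology.idealGrading I) (t + 1) =
        ⨆ A ∈ {A : Fin n →₀ ℕ | BorelCohomology.IsMinGen I A ∧
            (n : ℤ) - t ≤ BorelCohomology.maxIndex A},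
          BorelCohomology.toExt (A.degree : ℤ)) ∧
    (BorelCohomology.aStarT k n (BorelCohomology.quotGrading I) t =
        ⨆ A ∈ {A : Fin n →₀ ℕ | BorelCohomology.IsMinGen I A ∧
            (n : ℤ) - t ≤ BorelCohomology.maxIndex A},
          BorelCohomology.toExt ((A.degree : ℤ) + BorelCohomology.maxIndex A - n - 1)) ∧
    (BorelCohomology.aStarT k n (BorelCohomology.idealGrading I) (t + 1) =
        ⨆ A ∈ {A : Fin n →₀ ℕ | BorelCohomology.IsMinGen I A ∧
            (n : ℤ) - t ≤ BorelCohomology.maxIndex A},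
          BorelCohomology.toExt ((A.degree : ℤ) + BorelCohomology.maxIndex A - n - 1)) := by
  have hE := hI.isStronglyStable
  have hne := BorelCohomology.expSet_nonempty hI.1 hI0
  -- One generator is fixed to show `n > 0` and to dominate the contribution of the top local
  -- cohomology of `S` below.
  obtain ⟨A₀, hA₀⟩ := BorelCohomology.exists_isMinGen hne
  obtain ⟨j₀, _, _, hj₀⟩ := BorelCohomology.exists_maxIndex_eq (hA₀.ne_zero hI1)
  have hn : 0 < n := j₀.pos
  have hQ := BorelCohomology.nontrivial_quot_iff hI.1 hE
  have hJ := BorelCohomology.nontrivial_ideal_iff hI.1 hE hne hn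
  -- Both sides have the same upper bounds, so inequalities between generators and critical degrees
  -- suffice and attainment of suprema is not needed.
  refine ⟨?_, ?_, ?_, ?_⟩ <;> refine eq_of_forall_ge_iff fun x => ?_
  · rw [BorelCohomology.add_toExt_le_iff, BorelCohomology.regT_le_iff]
    simp only [iSup_le_iff, Set.mem_ofPred_eq, BorelCohomology.toExt_le_add_toExt_iff, hQ]
    constructor
    · rintro h A ⟨hA, hAt⟩
      obtain ⟨β, hβ, hc, hs⟩ := hA.exists_isCritical hE hI1
      exact (BorelCohomology.toExt_le_toExt.2 hs).trans (h _ (by omega) _ ⟨β, rfl, hβ, rfl⟩)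
    · rintro h i hi d ⟨α, rfl, hα, rfl⟩
      obtain ⟨A, hA, hc, hs⟩ := hα.exists_isMinGen hE hne hn
      exact (BorelCohomology.toExt_le_toExt.2 hs).trans (h A ⟨hA, by omega⟩)
  · rw [BorelCohomology.regT_le_iff]
    simp only [iSup_le_iff, Set.mem_ofPred_eq, hJ]
    constructor
    · rintro h A ⟨hA, hAt⟩
      obtain ⟨β, hβ, hc, hs⟩ := hA.exists_isCritical hE hI1
      exact (BorelCohomology.toExt_le_toExt.2 (by push_cast; omega)).trans
        (h _ (by omega) _ ⟨β, rfl, Or.inl ⟨hβ, rfl⟩⟩)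
    · rintro h i hi d ⟨α, rfl, ⟨hα, rfl⟩ | ⟨hα, rfl⟩⟩
      · obtain ⟨A, hA, hc, hs⟩ := hα.exists_isMinGen hE hne hn
        exact (BorelCohomology.toExt_le_toExt.2 (by push_cast; omega)).trans (h A ⟨hA, by omega⟩)
      -- Here `i = n ≤ t + 1`, so `A₀`, whose last index is at least 1, qualifies; its degree
      -- dominates `|α| + n ≤ 0`.
      · have := BorelCohomology.sum_le_neg_of_negSupport_eq_univ hα
        exact (BorelCohomology.toExt_le_toExt.2 (by omega)).trans (h A₀ ⟨hA₀, by omega⟩)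
  · rw [BorelCohomology.aStarT_le_iff]
    simp only [iSup_le_iff, Set.mem_ofPred_eq, hQ]
    constructor
    · rintro h A ⟨hA, hAt⟩
      obtain ⟨β, hβ, hc, hs⟩ := hA.exists_isCritical hE hI1
      exact (BorelCohomology.toExt_le_toExt.2 (by omega)).trans (h _ (by omega) _ ⟨β, rfl, hβ, rfl⟩)
    · rintro h i hi d ⟨α, rfl, hα, rfl⟩
      obtain ⟨A, hA, hc, hs⟩ := hα.exists_isMinGen hE hne hn
      exact (BorelCohomology.toExt_le_toExt.2 (by omega)).trans (h A ⟨hA, by omega⟩)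
  · rw [BorelCohomology.aStarT_le_iff]
    simp only [iSup_le_iff, Set.mem_ofPred_eq, hJ]
    constructor
    · rintro h A ⟨hA, hAt⟩
      obtain ⟨β, hβ, hc, hs⟩ := hA.exists_isCritical hE hI1
      exact (BorelCohomology.toExt_le_toExt.2 (by omega)).trans
        (h _ (by omega) _ ⟨β, rfl, Or.inl ⟨hβ, rfl⟩⟩)
    · rintro h i hi d ⟨α, rfl, ⟨hα, rfl⟩ | ⟨hα, rfl⟩⟩
      · obtain ⟨A, hA, hc, hs⟩ := hα.exists_isMinGen hE hne hn
        exact (BorelCohomology.toExt_le_toExt.2 (by omega)).trans (h A ⟨hA, by omega⟩)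
      -- Again `A₀` qualifies, and its value is at least `-n`, hence at least `|α|`.
      · have := BorelCohomology.sum_le_neg_of_negSupport_eq_univ hα
        have hdeg : 0 < A₀.degree := by
          rw [Nat.pos_iff_ne_zero, Ne, Finsupp.degree_eq_zero_iff]
          exact hA₀.ne_zero hI1
        exact (BorelCohomology.toExt_le_toExt.2 (by omega)).trans (h A₀ ⟨hA₀, by omega⟩)
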